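/- Let $M$ be a closed (compact, without boundary) smooth manifold, $\Bbbk=\mathbb R$ or $\mathbb C$, $A=C^\infty(M)$ the algebra of $\Bbbk$-valued smooth functions (vector fields and polyvector fields have $\Bbbk$-coefficients), and $\pi$ a Poisson bivector with bracket $\{\,,\}$. Let $$f\ast g=fg+\tfrac{\hbar}{2}\{f,g\}+\sum_{k\ge2}\hbar^kB_k(f,g),\qquad f,g\in A,$$ be an associative $\hbar$-bilinear product on $A[[\hbar]]$ whose coefficients $B_k$ are bidifferential operators, and put $B_1=\tfrac12\{\,,\}$. For a linear operator $D$ and a bilinear operator $c$ on $A$ put $$(\delta D)(f,g)=fD(g)-D(fg)+D(f)g,\qquad [c,D](f,g)=c(Df,g)+c(f,Dg)-D(c(f,g)).$$ Let $n\ge0$, let $X_0$ be a Poisson vector field and $X_1,\dots,X_n$ differential operators on $A$ such that $\mathcal X=\sum_k\hbar^kX_k$ satisfies $\mathcal X(f\ast g)=\mathcal X(f)\ast g+f\ast\mathcal X(g)$ up to degree $n$ in $\hbar$, for all $f,g\in A$. Consider $$R=-\sum_{k=1}^{n+1}[B_k,X_{n+1-k}].$$ Then: 1. $R$ is a local (bidifferential)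 Hochschild $2$-cocycle of $A$. 2. There is exactly one bivector field $\Phi$ whose class under the Hochschild–Kostant–Rosenberg map (which regards a bivector field as the bidifferential operator $(f,g)\mapsto\Phi(df,dg)$) equals the class of $R$ in the local Hochschild cohomology $H^2_{loc}(A)$, and $d_\pi\Phi=0$, where $d_\pi$ is the Lichnerowicz–Poisson differential on polyvector fields. Thus $R$ defines a class $[\Phi]$ in the second Lichnerowicz–Poisson cohomology of $(M,\pi)$. 3. The following are equivalent: (a) $[\Phi]=0$ in Lichnerowicz–Poisson cohomology; (b) there are a vector field $X'$ and a differential operator $X_{n+1}$ such that, after replacing $X_n$ by $X_n+X'$, one has $\delta X_{n+1}=-\sum_{k=1}^{n+1}[B_k,X_{n+1-k}]$; (c) there are a vector field $X'$ and a differential operator $X_{n+1}$ such that, after replacing $X_n$ by $X_n+X'$, the series $X_0,\dots,X_{n+1}$ makes $\mathcal X$ a derivation up to degree $n+1$ in $\hbar$. Here, if $n=0$, no adjustment is made ($X'=0$), so that $X_0$ is kept. -/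

import Mathlib

open scoped Manifold ContDiff

/-! The first part is written for a commutative algebra `A` over a field `𝕜`; in the theorem `A` is
the algebra of smooth functions on a closed manifold. -/

namespace DefQuant

section Cochains

variable (𝕜 A : Type*) [Field 𝕜] [AddCommGroup A] [Module 𝕜 A]

/-- Hochschild `1`-cochains: linear operators. -/
abbrev Cochain1 := A →ₗ[𝕜] A

/-- Hochschild `2`-cochains: bilinear operators, `c f g` being the value on `(f, g)`. -/
abbrev Cochain2 := A →ₗ[𝕜] A →ₗ[𝕜] A

/-- Hochschild `3`-cochains: trilinear operators. -/
abbrev Cochain3 := A →ₗ[𝕜] A →ₗ[𝕜] A →ₗ[𝕜] A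

end Cochains

section Algebra

variable {𝕜 A : Type*} [Field 𝕜] [CommRing A] [Algebra 𝕜 A]

/-- Subspaces of the space of `2`-cochains are additive groups (type class search does not find
this by itself). -/
instance instAddCommGroupCochain2 (p : Submodule 𝕜 (Cochain2 𝕜 A)) : AddCommGroup p :=
  @Submodule.addCommGroup 𝕜 (Cochain2 𝕜 A) _ _ _ p

/-! ### Differential operators and local cochains -/

/-- Differential operators of order at most `k` on a commutative algebra: order zero means
`A`-linear, and order at most `k + 1` means that all the commutators `[D, a]` with the
multiplication operators have order at most `k`. For the algebra of smooth functions on a compact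
manifold these are exactly the usual linear differential operators with smooth coefficients. -/
def IsDiffOpOfOrder : ℕ → Cochain1 𝕜 A → Prop
  | 0, D => ∀ a f : A, D (a * f) = a * D f
  | k + 1, D => ∀ a : A, IsDiffOpOfOrder k
      (D ∘ₗ LinearMap.mulLeft 𝕜 a - LinearMap.mulLeft 𝕜 a ∘ₗ D)

theorem IsDiffOpOfOrder.zero (k : ℕ) : IsDiffOpOfOrder k (0 : Cochain1 𝕜 A) := by
  induction k with
  | zero => intro a f; simp
  | succ k ih => intro a; simpa using ih

theorem IsDiffOpOfOrder.add {k : ℕ} {D D' : Cochain1 𝕜 A} (h : IsDiffOpOfOrder k D)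
    (h' : IsDiffOpOfOrder k D') : IsDiffOpOfOrder k (D + D') := by
  induction k generalizing D D' with
  | zero => intro a f; simp [h a f, h' a f, mul_add]
  | succ k ih =>
    intro a
    convert ih (h a) (h' a) using 1
    simp only [LinearMap.add_comp, LinearMap.comp_add]
    abel

theorem IsDiffOpOfOrder.smul {k : ℕ} (c : 𝕜) {D : Cochain1 𝕜 A} (h : IsDiffOpOfOrder k D) :
    IsDiffOpOfOrder k (c • D) := by
  induction k generalizing D with
  | zero => intro a f; simp [h a f]
  | succ k ih =>
    intro a
    convert ih (h a) using 1
    simp only [LinearMap.smul_comp, LinearMap.comp_smul, smul_sub]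

theorem IsDiffOpOfOrder.succ {k : ℕ} {D : Cochain1 𝕜 A} (h : IsDiffOpOfOrder k D) :
    IsDiffOpOfOrder (k + 1) D := by
  induction k generalizing D with
  | zero => intro a b f; simp [h a, h b]
  | succ k ih => intro a; exact ih (h a)

theorem IsDiffOpOfOrder.mono {k l : ℕ} (hkl : k ≤ l) {D : Cochain1 𝕜 A}
    (h : IsDiffOpOfOrder k D) : IsDiffOpOfOrder l D := by
  induction hkl with
  | refl => exact h
  | step _ ih => exact ih.succ

theorem isDiffOpOfOrder_derivation (X : Derivation 𝕜 A A) :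
    IsDiffOpOfOrder 1 (X : Cochain1 𝕜 A) := by
  intro a b f
  simp
  ring

variable (𝕜 A)

/-- The local `1`-cochains: differential operators (of arbitrary finite order). -/
def localCochain1 : Submodule 𝕜 (Cochain1 𝕜 A) where
  carrier := {D | ∃ k, IsDiffOpOfOrder k D}
  zero_mem' := ⟨0, IsDiffOpOfOrder.zero 0⟩
  add_mem' := by
    rintro D D' ⟨k, h⟩ ⟨l, h'⟩
    exact ⟨max k l, (h.mono (le_max_left _ _)).add (h'.mono (le_max_right _ _))⟩
  smul_mem' := by
    rintro c D ⟨k, h⟩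
    exact ⟨k, h.smul c⟩

/-- The local `2`-cochains: bidifferential operators, i.e. bilinear maps which are differential
operators in each argument when the other argument is fixed. -/
def localCochain2 : Submodule 𝕜 (Cochain2 𝕜 A) where
  carrier := {c | (∀ f, c f ∈ localCochain1 𝕜 A) ∧ ∀ g, c.flip g ∈ localCochain1 𝕜 A}
  zero_mem' := ⟨fun _ => Submodule.zero_mem _, fun _ => Submodule.zero_mem _⟩
  add_mem' := fun h h' => ⟨fun f => Submodule.add_mem _ (h.1 f) (h'.1 f),
    fun g => Submodule.add_mem _ (h.2 g) (h'.2 g)⟩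
  smul_mem' := fun c _ h => ⟨fun f => Submodule.smul_mem _ c (h.1 f),
    fun g => Submodule.smul_mem _ c (h.2 g)⟩

/-! ### Hochschild differential and Gerstenhaber bracket -/

/-- `(δ D)(f, g) = f D(g) - D(f g) + D(f) g`. -/
def hochschild1 : Cochain1 𝕜 A →ₗ[𝕜] Cochain2 𝕜 A where
  toFun D := LinearMap.mk₂ 𝕜 (fun f g => f * D g - D (f * g) + D f * g)
    (by intros; simp only [map_add, add_mul]; ring)
    (by intros; simp only [map_smul, smul_mul_assoc, smul_add, smul_sub])
    (by intros; simp only [map_add, mul_add]; ring)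
    (by intros; simp only [map_smul, mul_smul_comm, smul_add, smul_sub])
  map_add' D D' := by
    ext f g; simp only [LinearMap.mk₂_apply, LinearMap.add_apply]; ring
  map_smul' c D := by
    ext f g
    simp only [LinearMap.mk₂_apply, LinearMap.smul_apply, RingHom.id_apply, mul_smul_comm,
      smul_mul_assoc, smul_add, smul_sub]

variable {𝕜 A} in
@[simp] theorem hochschild1_apply (D : Cochain1 𝕜 A) (f g : A) :
    hochschild1 𝕜 A D f g = f * D g - D (f * g) + D f * g := rfl

/-- `(δ c)(f, g, h) = f c(g, h) - c(f g, h) + c(f, g h) - c(f, g) h`. -/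
def hochschild2 : Cochain2 𝕜 A →ₗ[𝕜] Cochain3 𝕜 A where
  toFun c := LinearMap.mk₂ 𝕜 (fun f g => LinearMap.mulLeft 𝕜 f ∘ₗ c g - c (f * g)
      + c f ∘ₗ LinearMap.mulLeft 𝕜 g - LinearMap.mulLeft 𝕜 (c f g))
    (by intros; ext h; simp [add_mul]; ring)
    (by intros; ext h; simp [smul_sub, smul_add])
    (by intros; ext h; simp [mul_add, add_mul]; ring)
    (by intros; ext h; simp [smul_sub, smul_add])
  map_add' c c' := by
    ext f g h; simp [mul_add, add_mul]; ring
  map_smul' a c := by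
    ext f g h; simp [smul_sub, smul_add]

variable {𝕜 A} in
@[simp] theorem hochschild2_apply (c : Cochain2 𝕜 A) (f g h : A) :
    hochschild2 𝕜 A c f g h = f * c g h - c (f * g) h + c f (g * h) - c f g * h := rfl

theorem hochschild2_hochschild1 (D : Cochain1 𝕜 A) :
    hochschild2 𝕜 A (hochschild1 𝕜 A D) = 0 := by
  ext f g h
  simp [mul_assoc]
  ring

/-- The local Hochschild `2`-cocycles. -/
def localCocycle2 : Submodule 𝕜 (Cochain2 𝕜 A) :=
  localCochain2 𝕜 A ⊓ LinearMap.ker (hochschild2 𝕜 A)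

/-- The coboundaries of local `1`-cochains. -/
def localCoboundary2 : Submodule 𝕜 (Cochain2 𝕜 A) :=
  (localCochain1 𝕜 A).map (hochschild1 𝕜 A)

/-- Second local Hochschild cohomology `H²_loc(A)`. -/
abbrev LocalHH2 := localCocycle2 𝕜 A ⧸ (localCoboundary2 𝕜 A).submoduleOf (localCocycle2 𝕜 A)

variable {𝕜 A}

/-- The Gerstenhaber bracket of a `2`-cochain and a `1`-cochain,
`[c, D](f, g) = c(D f, g) + c(f, D g) - D (c(f, g))`. -/
def gerstenhaber (c : Cochain2 𝕜 A) (D : Cochain1 𝕜 A) : Cochain2 𝕜 A :=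
  c ∘ₗ D + c.compl₂ D - c.compr₂ D

@[simp] theorem gerstenhaber_apply (c : Cochain2 𝕜 A) (D : Cochain1 𝕜 A) (f g : A) :
    gerstenhaber c D f g = c (D f) g + c f (D g) - D (c f g) := rfl

/-! ### Polyvector fields

Vector fields are derivations of the algebra of functions, and a polyvector field `Φ` of degree
`p` is the alternating multiderivation `(f₁, …, f_p) ↦ Φ(df₁, …, df_p)`. -/

variable (𝕜 A)

/-- Bivector fields: alternating biderivations. -/
def Bivector : Submodule 𝕜 (Cochain2 𝕜 A) where
  carrier := {Φ | (∀ f, Φ f f = 0) ∧ ∀ f g h, Φ f (g * h) = g * Φ f h + h * Φ f g}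
  zero_mem' := by simp
  add_mem' := by
    rintro Φ Ψ ⟨h, h'⟩ ⟨k, k'⟩
    refine ⟨fun f => by simp [h, k], fun f g l => ?_⟩
    simp only [LinearMap.add_apply, h', k']
    ring
  smul_mem' := by
    rintro c Φ ⟨h, h'⟩
    refine ⟨fun f => by simp [h], fun f g l => ?_⟩
    simp only [LinearMap.smul_apply, h', smul_add, mul_smul_comm]

/-- Trivector fields: alternating triderivations. -/
def Trivector : Submodule 𝕜 (Cochain3 𝕜 A) where
  carrier := {Φ | (∀ f g, Φ f f g = 0) ∧ (∀ f g, Φ f g g = 0) ∧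
    ∀ e f g h, Φ e f (g * h) = g * Φ e f h + h * Φ e f g}
  zero_mem' := by simp
  add_mem' := by
    rintro Φ Ψ ⟨h, h', h''⟩ ⟨k, k', k''⟩
    refine ⟨fun f g => by simp [h, k], fun f g => by simp [h', k'], fun e f g l => ?_⟩
    simp only [LinearMap.add_apply, h'', k'']
    ring
  smul_mem' := by
    rintro c Φ ⟨h, h', h''⟩
    refine ⟨fun f g => by simp [h], fun f g => by simp [h'], fun e f g l => ?_⟩
    simp only [LinearMap.smul_apply, h'', smul_add, mul_smul_comm]

variable {𝕜 A}

theorem Bivector.alt (Φ : Bivector 𝕜 A) (f : A) : Φ.1 f f = 0 := Φ.2.1 f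

theorem Bivector.skew (Φ : Bivector 𝕜 A) (f g : A) : Φ.1 f g = -Φ.1 g f := by
  have h := Φ.2.1 (f + g)
  simp only [map_add, LinearMap.add_apply, Φ.2.1 f, Φ.2.1 g, zero_add, add_zero] at h
  exact eq_neg_of_add_eq_zero_right h

theorem Bivector.leibniz (Φ : Bivector 𝕜 A) (f g h : A) :
    Φ.1 f (g * h) = g * Φ.1 f h + h * Φ.1 f g := Φ.2.2 f g h

theorem Bivector.leibniz_left (Φ : Bivector 𝕜 A) (f g h : A) :
    Φ.1 (f * g) h = f * Φ.1 g h + g * Φ.1 f h := by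
  rw [Bivector.skew Φ, Bivector.leibniz Φ, Bivector.skew Φ h g, Bivector.skew Φ h f]
  ring

theorem Bivector.mem_localCochain2 (Φ : Bivector 𝕜 A) : Φ.1 ∈ localCochain2 𝕜 A := by
  refine ⟨fun f => ⟨1, fun a b g => ?_⟩, fun f => ⟨1, fun a b g => ?_⟩⟩
  · simp [Bivector.leibniz Φ]; ring
  · simp [Bivector.leibniz_left Φ]; ring

theorem Bivector.mem_localCocycle2 (Φ : Bivector 𝕜 A) : Φ.1 ∈ localCocycle2 𝕜 A := by
  refine ⟨Bivector.mem_localCochain2 Φ, LinearMap.mem_ker.2 ?_⟩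
  ext f g h
  simp [Bivector.leibniz Φ, Bivector.leibniz_left Φ]
  ring

variable (𝕜 A) in
/-- The Hochschild-Kostant-Rosenberg map in degree two: it sends a bivector field `Φ` to the class
of the bidifferential operator `(f, g) ↦ (Φ(df, dg) - Φ(dg, df)) / 2 = Φ(df, dg)`. -/
def hkr : Bivector 𝕜 A →ₗ[𝕜] LocalHH2 𝕜 A :=
  Submodule.mkQ _ ∘ₗ Submodule.inclusion (fun Φ hΦ => Bivector.mem_localCocycle2 ⟨Φ, hΦ⟩)

/-! ### Poisson structures and Lichnerowicz-Poisson cohomology -/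

variable (𝕜 A) in
/-- A Poisson structure: a bivector field whose bracket `{f, g} = π(df, dg)` satisfies the Jacobi
identity. -/
structure Poisson where
  /-- The Poisson bivector. -/
  π : Bivector 𝕜 A
  jacobi : ∀ f g h, π.1 f (π.1 g h) + π.1 g (π.1 h f) + π.1 h (π.1 f g) = 0

namespace Poisson

variable (P : Poisson 𝕜 A)

/-- The Poisson bracket `{f, g}`. -/
def bracket : Cochain2 𝕜 A := P.π.1

theorem jacobi' (f g h : A) : P.π.1 (P.π.1 f g) h = P.π.1 f (P.π.1 g h) - P.π.1 g (P.π.1 f h) := by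
  have h1 := P.jacobi f g h
  rw [Bivector.skew P.π h f, Bivector.skew P.π h (P.π.1 f g), map_neg] at h1
  linear_combination -h1

/-- A vector field `X` is Poisson if `X{f, g} = {X f, g} + {f, X g}`. -/
def IsPoissonField (X : Derivation 𝕜 A A) : Prop :=
  ∀ f g, X (P.bracket f g) = P.bracket (X f) g + P.bracket f (X g)

/-- The Lichnerowicz differential on vector fields,
`(d_π Y)(f, g) = {f, Y g} - {g, Y f} - Y{f, g}`. -/
def d1 : Derivation 𝕜 A A →ₗ[𝕜] Bivector 𝕜 A where
  toFun Y := ⟨LinearMap.mk₂ 𝕜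
      (fun f g => P.bracket f (Y g) - P.bracket g (Y f) - Y (P.bracket f g))
      (by intros; simp only [map_add, LinearMap.add_apply]; ring)
      (by intros; simp only [map_smul, LinearMap.smul_apply, Derivation.map_smul, smul_sub])
      (by intros; simp only [map_add, LinearMap.add_apply]; ring)
      (by intros; simp only [map_smul, LinearMap.smul_apply, Derivation.map_smul, smul_sub]), by
    refine ⟨fun f => ?_, fun f g h => ?_⟩
    · simp [bracket, Bivector.alt P.π]
    · simp [bracket, Bivector.leibniz P.π, Bivector.leibniz_left P.π]
      rw [Bivector.skew P.π g (Y f), Bivector.skew P.π h (Y f)]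
      ring⟩
  map_add' Y Z := by
    ext f g; simp; ring
  map_smul' c Y := by
    ext f g; simp [smul_sub]

@[simp] theorem d1_apply (Y : Derivation 𝕜 A A) (f g : A) :
    (P.d1 Y).1 f g = P.bracket f (Y g) - P.bracket g (Y f) - Y (P.bracket f g) := rfl

/-- The Lichnerowicz differential on bivector fields,
`(d_π Φ)(f, g, h) = {f, Φ(g, h)} - {g, Φ(f, h)} + {h, Φ(f, g)}
  - Φ({f, g}, h) + Φ({f, h}, g) - Φ({g, h}, f)`. -/
def d2 : Bivector 𝕜 A →ₗ[𝕜] Trivector 𝕜 A where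
  toFun Φ := ⟨LinearMap.mk₂ 𝕜
      (fun f g => P.bracket f ∘ₗ Φ.1 g - P.bracket g ∘ₗ Φ.1 f + P.bracket.flip (Φ.1 f g)
        - Φ.1 (P.bracket f g) + (Φ.1.flip g) ∘ₗ P.bracket f - (Φ.1.flip f) ∘ₗ P.bracket g)
      (by intros; ext h; simp; ring)
      (by intros; ext h; simp [smul_sub, smul_add])
      (by intros; ext h; simp; ring)
      (by intros; ext h; simp [smul_sub, smul_add]), by
    refine ⟨fun f g => ?_, fun f g => ?_, fun e f g h => ?_⟩
    · simp [bracket, Bivector.alt]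
    · simp [bracket, Bivector.alt]
    · simp [bracket, Bivector.leibniz, Bivector.leibniz_left]
      rw [Bivector.skew Φ g e, Bivector.skew Φ g f, Bivector.skew Φ h e, Bivector.skew Φ h f]
      ring⟩
  map_add' Φ Ψ := by
    ext f g h; simp; ring
  map_smul' c Φ := by
    ext f g h; simp [smul_sub, smul_add]

@[simp] theorem d2_apply (Φ : Bivector 𝕜 A) (f g h : A) :
    (P.d2 Φ).1 f g h = P.bracket f (Φ.1 g h) - P.bracket g (Φ.1 f h) + P.bracket h (Φ.1 f g)
      - Φ.1 (P.bracket f g) h + Φ.1 (P.bracket f h) g - Φ.1 (P.bracket g h) f := rfl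

theorem d2_d1 (Y : Derivation 𝕜 A A) : P.d2 (P.d1 Y) = 0 := by
  ext f g h
  have sk : ∀ a b c, P.π.1 a (P.π.1 b c) = -P.π.1 a (P.π.1 c b) := fun a b c => by
    rw [Bivector.skew P.π b c, map_neg]
  have jY := congrArg Y (P.jacobi f g h)
  have jS := congrArg Y (sk g f h)
  simp only [map_add, map_zero, map_neg] at jY jS
  simp only [d2_apply, d1_apply, bracket, map_sub, Bivector.skew P.π (P.π.1 _ _) _, map_neg]
  change _ = (0 : A)
  linear_combination P.jacobi f g (Y h) + P.jacobi f (Y g) h + P.jacobi (Y f) g h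
    - jY - sk f h (Y g) - sk g f (Y h) - sk h g (Y f) - sk (Y g) f h + jS

/-- Second Lichnerowicz-Poisson cohomology: the kernel of `d_π` on bivector fields modulo the
image of `d_π` on vector fields. -/
abbrev H2 := LinearMap.ker P.d2 ⧸ (LinearMap.range P.d1).submoduleOf (LinearMap.ker P.d2)

/-- The class in Lichnerowicz-Poisson cohomology of a `d_π`-closed bivector field. -/
def H2class (Φ : Bivector 𝕜 A) (hΦ : P.d2 Φ = 0) : P.H2 :=
  Submodule.Quotient.mk ⟨Φ, hΦ⟩

end Poisson

/-- The class in local Hochschild cohomology of a local cocycle. -/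
def hochschildClass (c : Cochain2 𝕜 A) (hc : c ∈ localCocycle2 𝕜 A) : LocalHH2 𝕜 A :=
  Submodule.Quotient.mk ⟨c, hc⟩

/-! ### Star products and formal operators -/

/-- The product `a ∗ b = ∑ ħᵏ Bₖ(a, b)`, extended `ħ`-linearly to formal power series in `ħ`. -/
noncomputable def starMul (B : ℕ → Cochain2 𝕜 A) (a b : PowerSeries A) : PowerSeries A :=
  PowerSeries.mk fun m => ∑ p ∈ Finset.HasAntidiagonal.antidiagonal m, ∑ q ∈ Finset.HasAntidiagonal.antidiagonal p.2,
    B p.1 (PowerSeries.coeff q.1 a) (PowerSeries.coeff q.2 b)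

/-- The operator `𝒳 = ∑ ħᵏ Xₖ`, extended `ħ`-linearly to formal power series in `ħ`. -/
noncomputable def formalOp (X : ℕ → Cochain1 𝕜 A) (a : PowerSeries A) : PowerSeries A :=
  PowerSeries.mk fun m => ∑ p ∈ Finset.HasAntidiagonal.antidiagonal m, X p.1 (PowerSeries.coeff p.2 a)

/-- A deformation quantization of the Poisson algebra `(A, P)`: an associative product
`f ∗ g = f g + (ħ / 2) {f, g} + ∑_{k ≥ 2} ħᵏ Bₖ(f, g)` with bidifferential operators `Bₖ`. -/
structure StarProduct (P : Poisson 𝕜 A) where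
  /-- The coefficients. -/
  B : ℕ → Cochain2 𝕜 A
  B_zero : ∀ f g, B 0 f g = f * g
  B_one : ∀ f g, B 1 f g = (2⁻¹ : 𝕜) • P.bracket f g
  B_local : ∀ k, B k ∈ localCochain2 𝕜 A
  assoc : ∀ f g h : A,
    starMul B (starMul B (PowerSeries.C f) (PowerSeries.C g)) (PowerSeries.C h) =
      starMul B (PowerSeries.C f) (starMul B (PowerSeries.C g) (PowerSeries.C h))

namespace StarProduct

variable {P : Poisson 𝕜 A} (S : StarProduct P)

/-- `𝒳 = ∑ ħᵏ Xₖ` is a derivation up to degree `n` in `ħ`: the two sides of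
`𝒳(f ∗ g) = 𝒳(f) ∗ g + f ∗ 𝒳(g)` have the same coefficients at `ħᵐ` for all `m ≤ n`. Only
`X₀, …, Xₙ` enter this condition. -/
def IsDerivationUpTo (n : ℕ) (X : ℕ → Cochain1 𝕜 A) : Prop :=
  ∀ f g : A, ∀ m ≤ n,
    PowerSeries.coeff m (formalOp X (starMul S.B (PowerSeries.C f) (PowerSeries.C g))) =
      PowerSeries.coeff m (starMul S.B (formalOp X (PowerSeries.C f)) (PowerSeries.C g) +
        starMul S.B (PowerSeries.C f) (formalOp X (PowerSeries.C g)))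

/-- The right-hand side `-∑_{k=1}^{n+1} [Bₖ, X_{n+1-k}]` of the equation for `X_{n+1}`. -/
def rhs (n : ℕ) (X : ℕ → Cochain1 𝕜 A) : Cochain2 𝕜 A :=
  -∑ k ∈ Finset.Icc 1 (n + 1), gerstenhaber (S.B k) (X (n + 1 - k))

end StarProduct

end Algebra

/-! ### Smooth functions on a manifold -/

/-- The algebra `C^∞(M)` of smooth `𝕜`-valued functions, where `𝕜` is `ℝ` or `ℂ`. -/
def SmoothFunctions (𝕜 : Type*) [RCLike 𝕜] (d : ℕ) (M : Type*) [TopologicalSpace M]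
    [ChartedSpace (EuclideanSpace ℝ (Fin d)) M] : Subalgebra 𝕜 (M → 𝕜) where
  carrier := {f | ContMDiff (𝓡 d) 𝓘(ℝ, 𝕜) ∞ f}
  mul_mem' := fun hf hg => by
    exact contDiff_mul.comp_contMDiff (hf.prodMk_space hg)
  add_mem' := fun hf hg => by
    exact ContMDiff.add hf hg
  algebraMap_mem' := fun _ => contMDiff_const

end DefQuant

/-! The argument separates a geometric input from formal algebra. The geometric input is a dual
frame: finitely many functions `x i` and derivations `e i` with `Y f = ∑ Y (x i) * e i f` for every
derivation `Y`. On a compact manifold it is assembled from cut-off chart coordinates. The weights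
admitting a local version of this formula form an ideal, and compactness puts a nowhere vanishing
function into it (`exists_isDualFrame_smoothFunctions`).

A dual frame gives the Hochschild–Kostant–Rosenberg theorem in degree two. The essential point is
that a symmetric local cocycle is the coboundary of a differential operator
(`IsDualFrame.mem_localCoboundary2`). Its order on the coordinates is lowered step by step, by a
homotopy resting on Euler's identity for principal symbols. Hence the class of a local cocycle
contains exactly one bivector field, its antisymmetrization.

For the obstruction, associativity says `[B, B] = 0`, so the graded Jacobi identity gives `[B, [B,
𝒳]] = 0`. This is `StarProduct.sum_defect_eq_zero`. For `𝒳` truncated after degree `n`, the first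
nonzero coefficient of `[B, 𝒳]` can only be `-R`, in degree `n + 1`. The coefficient of the Jacobi
identity in degree `n + 1` then says that `R` is a cocycle. The next one says that the bracket of
`R` with the Poisson structure is a coboundary, and antisymmetrizing it gives `d_π Φ = 0`.

Adding a vector field `Y` to `X n` changes `R` by `-(1/2) d_π Y`. The next equation is therefore
solvable after a correction exactly when `Φ` is exact. For `n = 0` the obstruction vanishes
outright, since `X₀` is Poisson. -/

namespace DefQuant

/-! ### Order filtration of differential operators and its stability properties. -/

section DifferentialOperators

variable {𝕜 A : Type*} [Field 𝕜] [CommRing A] [Algebra 𝕜 A]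

/-- `Submodule.sub_mem` for `2`-cochains, where unification does not find the group structure. -/
theorem sub_mem_of_cochain2 {p : Submodule 𝕜 (Cochain2 𝕜 A)} {c c' : Cochain2 𝕜 A} (hc : c ∈ p)
    (hc' : c' ∈ p) : c - c' ∈ p := by
  have : c - c' = c + (-1 : 𝕜) • c' := by
    ext f g
    simp [sub_eq_add_neg]
  rw [this]
  exact p.add_mem hc (p.smul_mem _ hc')

/-- The commutator `[D, a]` of an operator with a multiplication operator. -/
def comm (a : A) : Cochain1 𝕜 A →ₗ[𝕜] Cochain1 𝕜 A where
  toFun D := D ∘ₗ LinearMap.mulLeft 𝕜 a - LinearMap.mulLeft 𝕜 a ∘ₗ D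
  map_add' D D' := by ext; simp [mul_add]; ring
  map_smul' c D := by ext; simp [smul_sub]

@[simp] theorem comm_apply (a : A) (D : Cochain1 𝕜 A) (f : A) :
    comm a D f = D (a * f) - a * D f := rfl

theorem comm_comm (a b : A) (D : Cochain1 𝕜 A) : comm a (comm b D) = comm b (comm a D) := by
  ext f
  simp only [comm_apply, mul_left_comm a b]
  ring

theorem comm_comp (a : A) (D E : Cochain1 𝕜 A) :
    comm a (D ∘ₗ E) = comm a D ∘ₗ E + D ∘ₗ comm a E := by
  ext f; simp

theorem comm_mulLeft (a u : A) : comm a (LinearMap.mulLeft 𝕜 u) = 0 := by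
  ext f; simp; ring

theorem comm_derivation (a : A) (Y : Derivation 𝕜 A A) :
    comm a (Y : Cochain1 𝕜 A) = LinearMap.mulLeft 𝕜 (Y a) := by
  ext f; simp; ring

/-- Differential operators of order less than `k`. -/
def OrderLT : ℕ → Cochain1 𝕜 A → Prop
  | 0, D => D = 0
  | k + 1, D => IsDiffOpOfOrder k D

/-- The shift by one makes zero the bottom of the filtration, so that order zero is also
characterized by commutators and inductions on the order have a trivial start. -/
theorem orderLT_succ_iff {k : ℕ} {D : Cochain1 𝕜 A} :
    OrderLT (k + 1) D ↔ ∀ a, OrderLT k (comm a D) := by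
  cases k with
  | zero =>
    simp only [OrderLT, IsDiffOpOfOrder]
    refine forall_congr' fun a => ?_
    simp [LinearMap.ext_iff, sub_eq_zero]
  | succ k => rfl

/-- The differential operators of order less than `k`, as a subspace. -/
def orderLT (𝕜 A : Type*) [Field 𝕜] [CommRing A] [Algebra 𝕜 A] (k : ℕ) :
    Submodule 𝕜 (Cochain1 𝕜 A) where
  carrier := {D | OrderLT k D}
  zero_mem' := by
    cases k with
    | zero => rfl
    | succ k => exact IsDiffOpOfOrder.zero k
  add_mem' := by
    intro D E hD hE
    cases k with
    | zero => simp_all [OrderLT]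
    | succ k => exact IsDiffOpOfOrder.add hD hE
  smul_mem' := by
    intro c D hD
    cases k with
    | zero => simp_all [OrderLT]
    | succ k => exact IsDiffOpOfOrder.smul c hD

theorem mem_orderLT_zero {D : Cochain1 𝕜 A} : D ∈ orderLT 𝕜 A 0 ↔ D = 0 := Iff.rfl

theorem mem_orderLT_succ {k : ℕ} {D : Cochain1 𝕜 A} :
    D ∈ orderLT 𝕜 A (k + 1) ↔ ∀ a, comm a D ∈ orderLT 𝕜 A k := orderLT_succ_iff

theorem mem_orderLT_one {D : Cochain1 𝕜 A} :
    D ∈ orderLT 𝕜 A 1 ↔ ∀ a f, D (a * f) = a * D f := Iff.rfl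

theorem orderLT_le_succ (k : ℕ) : orderLT 𝕜 A k ≤ orderLT 𝕜 A (k + 1) := by
  intro D hD
  cases k with
  | zero => rw [mem_orderLT_zero.1 hD]; exact Submodule.zero_mem _
  | succ k => exact IsDiffOpOfOrder.succ hD

theorem orderLT_mono : Monotone (orderLT 𝕜 A) := monotone_nat_of_le_succ orderLT_le_succ

theorem mem_localCochain1 {D : Cochain1 𝕜 A} :
    D ∈ localCochain1 𝕜 A ↔ ∃ k, D ∈ orderLT 𝕜 A k :=
  ⟨fun ⟨k, h⟩ => ⟨k + 1, h⟩, fun ⟨k, h⟩ => ⟨k, orderLT_le_succ k h⟩⟩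

theorem mulLeft_mem_orderLT (a : A) : LinearMap.mulLeft 𝕜 a ∈ orderLT 𝕜 A 1 :=
  mem_orderLT_one.2 fun b f => by simp [mul_left_comm]

theorem derivation_mem_orderLT (Y : Derivation 𝕜 A A) :
    (Y : Cochain1 𝕜 A) ∈ orderLT 𝕜 A 2 := isDiffOpOfOrder_derivation Y

/-- The commutator with a function is a derivation of composition, so orders add. With strict
bounds, `< k` and `< l` compose to `< k + l - 1`, which accounts for the form of `hm`. -/
theorem comp_mem_orderLT {k l m : ℕ} (hm : k + l ≤ m + 1) {D E : Cochain1 𝕜 A}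
    (hD : D ∈ orderLT 𝕜 A k) (hE : E ∈ orderLT 𝕜 A l) : D ∘ₗ E ∈ orderLT 𝕜 A m := by
  induction m generalizing k l D E with
  | zero =>
    obtain rfl | rfl : k = 0 ∨ l = 0 := by omega
    · rw [mem_orderLT_zero.1 hD, LinearMap.zero_comp]; exact Submodule.zero_mem _
    · rw [mem_orderLT_zero.1 hE, LinearMap.comp_zero]; exact Submodule.zero_mem _
  | succ m ih =>
    rcases k with _ | k
    · rw [mem_orderLT_zero.1 hD, LinearMap.zero_comp]; exact Submodule.zero_mem _
    rcases l with _ | l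
    · rw [mem_orderLT_zero.1 hE, LinearMap.comp_zero]; exact Submodule.zero_mem _
    refine mem_orderLT_succ.2 fun a => ?_
    rw [comm_comp]
    exact Submodule.add_mem _ (ih (by omega) (mem_orderLT_succ.1 hD a) hE)
      (ih (by omega) hD (mem_orderLT_succ.1 hE a))

theorem comp_mem_localCochain1 {D E : Cochain1 𝕜 A} (hD : D ∈ localCochain1 𝕜 A)
    (hE : E ∈ localCochain1 𝕜 A) : D ∘ₗ E ∈ localCochain1 𝕜 A := by
  obtain ⟨k, hk⟩ := mem_localCochain1.1 hD
  obtain ⟨l, hl⟩ := mem_localCochain1.1 hE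
  exact mem_localCochain1.2 ⟨k + l, comp_mem_orderLT (by omega) hk hl⟩

theorem comm_mem_localCochain1 {D : Cochain1 𝕜 A} (a : A) (hD : D ∈ localCochain1 𝕜 A) :
    comm a D ∈ localCochain1 𝕜 A := by
  obtain ⟨k, hk⟩ := mem_localCochain1.1 hD
  exact mem_localCochain1.2 ⟨k, mem_orderLT_succ.1 (orderLT_le_succ k hk) a⟩

theorem mulLeft_mem_localCochain1 (a : A) : LinearMap.mulLeft 𝕜 a ∈ localCochain1 𝕜 A :=
  mem_localCochain1.2 ⟨1, mulLeft_mem_orderLT a⟩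

theorem derivation_mem_localCochain1 (Y : Derivation 𝕜 A A) :
    (Y : Cochain1 𝕜 A) ∈ localCochain1 𝕜 A :=
  mem_localCochain1.2 ⟨2, derivation_mem_orderLT Y⟩

theorem hochschild1_mem_localCochain2 {D : Cochain1 𝕜 A} (hD : D ∈ localCochain1 𝕜 A) :
    hochschild1 𝕜 A D ∈ localCochain2 𝕜 A := by
  have key : ∀ f, LinearMap.mulLeft 𝕜 f ∘ₗ D - D ∘ₗ LinearMap.mulLeft 𝕜 f
      + LinearMap.mulLeft 𝕜 (D f) ∈ localCochain1 𝕜 A := fun f =>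
    Submodule.add_mem _ (Submodule.sub_mem _
      (comp_mem_localCochain1 (mulLeft_mem_localCochain1 f) hD)
      (comp_mem_localCochain1 hD (mulLeft_mem_localCochain1 f))) (mulLeft_mem_localCochain1 _)
  refine ⟨fun f => ?_, fun f => ?_⟩
  · convert key f using 1
    ext g
    simp
  · convert key f using 1
    ext g
    simp [mul_comm]
    ring

theorem gerstenhaber_mem_localCochain2 {c : Cochain2 𝕜 A} {D : Cochain1 𝕜 A}
    (hc : c ∈ localCochain2 𝕜 A) (hD : D ∈ localCochain1 𝕜 A) :
    gerstenhaber c D ∈ localCochain2 𝕜 A := by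
  refine ⟨fun f => ?_, fun g => ?_⟩
  · have : gerstenhaber c D f = c (D f) + c f ∘ₗ D - D ∘ₗ c f := by ext; simp
    rw [this]
    exact Submodule.sub_mem _ (Submodule.add_mem _ (hc.1 _) (comp_mem_localCochain1 (hc.1 _) hD))
      (comp_mem_localCochain1 hD (hc.1 _))
  · have : (gerstenhaber c D).flip g = c.flip g ∘ₗ D + c.flip (D g) - D ∘ₗ c.flip g := by
      ext; simp
    rw [this]
    exact Submodule.sub_mem _ (Submodule.add_mem _ (comp_mem_localCochain1 (hc.2 _) hD) (hc.2 _))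
      (comp_mem_localCochain1 hD (hc.2 _))

end DifferentialOperators

/-! ### Principal symbols in terms of a dual frame. -/

section DualFrame

variable {𝕜 A : Type*} [Field 𝕜] [CommRing A] [Algebra 𝕜 A]

/-- Functions `xᵢ` and derivations `∂ᵢ` with `Y = ∑ Y(xᵢ) ∂ᵢ` for all derivations `Y`. -/
def IsDualFrame {ι : Type*} [Fintype ι] (x : ι → A) (e : ι → Derivation 𝕜 A A) : Prop :=
  ∀ (Y : Derivation 𝕜 A A) (f : A), Y f = ∑ i, Y (x i) * e i f

variable {ι : Type*} [Fintype ι] {x : ι → A} {e : ι → Derivation 𝕜 A A}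

/-- An operator commuting with the coordinates of a dual frame is a multiplication operator. -/
theorem IsDualFrame.mem_orderLT_one_of_comm_eq_zero (h : IsDualFrame x e) {m : ℕ}
    {L : Cochain1 𝕜 A} (hL : L ∈ orderLT 𝕜 A m) (hx : ∀ i, comm (x i) L = 0) :
    L ∈ orderLT 𝕜 A 1 := by
  induction m generalizing L with
  | zero => exact orderLT_mono zero_le_one hL
  | succ m ih =>
    have hlin : ∀ a f, comm a L f = f * comm a L 1 := fun a f => by
      have := mem_orderLT_one.1 (ih (mem_orderLT_succ.1 hL a)
        fun i => by rw [comm_comm, hx, map_zero]) f 1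
      rwa [mul_one] at this
    -- By induction each commutator of `L` is multiplication by its value at `1`. That value depends
    -- on `a` as a derivation killing every `x i`, hence vanishes.
    let Y : Derivation 𝕜 A A := Derivation.mk'
      { toFun := fun a => comm a L 1
        map_add' := fun a b => by simp [add_mul]; ring
        map_smul' := fun c a => by simp [smul_sub] }
      (fun a b => by
        have h1 := hlin a b
        simp at h1 ⊢
        linear_combination h1)
    have hY : ∀ a, Y a = comm a L 1 := fun a => rfl
    refine mem_orderLT_succ.2 fun a => mem_orderLT_zero.2 (LinearMap.ext fun f => ?_)
    rw [hlin, ← hY, h Y a]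
    simp [hY, hx]

/-- Commutators with functions commute with each other, so `comm a Q` inherits the hypothesis one
level lower. Finite order of `Q` is needed where the descent ends. -/
theorem IsDualFrame.mem_orderLT_succ (h : IsDualFrame x e) {k : ℕ} {Q : Cochain1 𝕜 A}
    (hQ : Q ∈ localCochain1 𝕜 A) (hx : ∀ i, comm (x i) Q ∈ orderLT 𝕜 A k) :
    Q ∈ orderLT 𝕜 A (k + 1) := by
  induction k generalizing Q with
  | zero =>
    obtain ⟨m, hm⟩ := mem_localCochain1.1 hQ
    exact h.mem_orderLT_one_of_comm_eq_zero hm hx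
  | succ k ih =>
    refine DefQuant.mem_orderLT_succ.2 fun a => ih (comm_mem_localCochain1 a hQ) fun i => ?_
    rw [comm_comm]
    exact DefQuant.mem_orderLT_succ.1 (hx i) a

/-- A map into operators of order at most `k` which is a derivation modulo operators of lower
order is determined modulo lower order by its values on the coordinates. -/
theorem IsDualFrame.sub_sum_mem_orderLT (h : IsDualFrame x e) {k : ℕ}
    (T : A →ₗ[𝕜] Cochain1 𝕜 A) (hT : ∀ a, T a ∈ orderLT 𝕜 A (k + 1))
    (hder : ∀ a b, T (a * b) - LinearMap.mulLeft 𝕜 a ∘ₗ T b - LinearMap.mulLeft 𝕜 b ∘ₗ T a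
      ∈ orderLT 𝕜 A k) (a : A) :
    T a - ∑ i, LinearMap.mulLeft 𝕜 (e i a) ∘ₗ T (x i) ∈ orderLT 𝕜 A k := by
  induction k generalizing T a with
  | zero =>
    have hlin : ∀ a f, T a f = f * T a 1 := fun a f => by
      have := mem_orderLT_one.1 (hT a) f 1
      rwa [mul_one] at this
    let Y : Derivation 𝕜 A A := Derivation.mk'
      { toFun := fun a => T a 1
        map_add' := fun a b => by simp
        map_smul' := fun c a => by simp }
      (fun a b => by
        have h1 := LinearMap.congr_fun (mem_orderLT_zero.1 (hder a b)) 1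
        simp at h1 ⊢
        linear_combination h1)
    have hY : ∀ a, Y a = T a 1 := fun a => rfl
    refine mem_orderLT_zero.2 (LinearMap.ext fun f => ?_)
    simp only [LinearMap.sub_apply, LinearMap.sum_apply, LinearMap.comp_apply,
      LinearMap.mulLeft_apply, LinearMap.zero_apply]
    rw [hlin a f, ← hY, h Y a, sub_eq_zero, Finset.mul_sum]
    refine Finset.sum_congr rfl fun i _ => ?_
    rw [hlin (x i) f, hY]
    ring
  | succ k ih =>
    refine DefQuant.mem_orderLT_succ.2 fun b => ?_
    -- Commutation with `b` preserves the derivation property modulo lower order and kills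
    -- multiplication operators, so it passes through the coefficients `e i a`.
    have hb := ih (comm b ∘ₗ T) (fun a => DefQuant.mem_orderLT_succ.1 (hT a) b)
      (fun a a' => by
        have := DefQuant.mem_orderLT_succ.1 (hder a a') b
        simpa [map_sub, comm_comp, comm_mulLeft] using this) a
    simpa [map_sub, comm_comp, comm_mulLeft] using hb

variable (x e) in
/-- The operator `N(Q) = ∑ [Q, xᵢ] ∂ᵢ`, which multiplies the principal symbol by its degree. -/
def eulerOp : Cochain1 𝕜 A →ₗ[𝕜] Cochain1 𝕜 A where
  toFun Q := ∑ i, comm (x i) Q ∘ₗ (e i : Cochain1 𝕜 A)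
  map_add' Q Q' := by simp [LinearMap.add_comp, Finset.sum_add_distrib]
  map_smul' c Q := by simp [LinearMap.smul_comp, Finset.smul_sum]

theorem eulerOp_apply (Q : Cochain1 𝕜 A) :
    eulerOp x e Q = ∑ i, comm (x i) Q ∘ₗ (e i : Cochain1 𝕜 A) := rfl

theorem comm_sum_comp (P : ι → Cochain1 𝕜 A) (a : A) :
    comm a (∑ i, P i ∘ₗ (e i : Cochain1 𝕜 A)) =
      ∑ i, comm a (P i) ∘ₗ (e i : Cochain1 𝕜 A) + ∑ i, P i ∘ₗ LinearMap.mulLeft 𝕜 (e i a) := by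
  simp only [map_sum, comm_comp, comm_derivation, Finset.sum_add_distrib]

/-- The variant of `IsDualFrame.sub_sum_mem_orderLT` with the coefficients on the right. -/
theorem IsDualFrame.sub_sum_comp_mem_orderLT (h : IsDualFrame x e) {k : ℕ}
    (T : A →ₗ[𝕜] Cochain1 𝕜 A) (hT : ∀ a, T a ∈ orderLT 𝕜 A (k + 1))
    (hder : ∀ a b, T (a * b) - LinearMap.mulLeft 𝕜 a ∘ₗ T b - LinearMap.mulLeft 𝕜 b ∘ₗ T a
      ∈ orderLT 𝕜 A k) (a : A) :
    ∑ i, T (x i) ∘ₗ LinearMap.mulLeft 𝕜 (e i a) - T a ∈ orderLT 𝕜 A k := by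
  have h1 := h.sub_sum_mem_orderLT T hT hder a
  -- Moving a coefficient across the operator costs a commutator, which has lower order.
  have h2 : ∑ i, comm (e i a) (T (x i)) ∈ orderLT 𝕜 A k :=
    Submodule.sum_mem _ fun i _ => DefQuant.mem_orderLT_succ.1 (hT _) _
  convert Submodule.sub_mem _ h2 h1 using 1
  ext f
  simp [LinearMap.sum_apply]

/-- Euler's identity for the principal symbol, a homogeneous polynomial of degree `k`. Commuting
`eulerOp x e Q` with `b` gives the same operator for `comm b Q`, plus one more copy of `comm b Q`
modulo lower order; this extra copy raises the degree by one. -/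
theorem IsDualFrame.eulerOp_sub_mem_orderLT (h : IsDualFrame x e) {k : ℕ} {Q : Cochain1 𝕜 A}
    (hQ : Q ∈ orderLT 𝕜 A (k + 1)) : eulerOp x e Q - (k : 𝕜) • Q ∈ orderLT 𝕜 A k := by
  induction k generalizing Q with
  | zero =>
    rw [mem_orderLT_zero, eulerOp_apply]
    have : ∀ i, comm (x i) Q = 0 := fun i =>
      mem_orderLT_zero.1 (DefQuant.mem_orderLT_succ.1 hQ _)
    simp [this]
  | succ k ih =>
    refine DefQuant.mem_orderLT_succ.2 fun b => ?_
    have h1 := ih (DefQuant.mem_orderLT_succ.1 hQ b)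
    let T : A →ₗ[𝕜] Cochain1 𝕜 A :=
      { toFun := fun a => comm a Q
        map_add' := fun a a' => by ext f; simp [add_mul]; ring
        map_smul' := fun c a => by ext f; simp [smul_sub] }
    have hTa : ∀ a, T a = comm a Q := fun _ => rfl
    have h2 := h.sub_sum_comp_mem_orderLT T (fun a => DefQuant.mem_orderLT_succ.1 hQ a)
      (fun a a' => by
        convert DefQuant.mem_orderLT_succ.1 (DefQuant.mem_orderLT_succ.1 hQ a) a' using 1
        ext f
        simp [hTa, mul_assoc, mul_left_comm a a']
        ring) b
    rw [map_sub, eulerOp_apply, comm_sum_comp, map_smul]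
    convert Submodule.add_mem _ h1 h2 using 1
    simp only [eulerOp_apply, hTa, comm_comm b, Nat.cast_succ, add_smul, one_smul]
    abel

/-! ### Symmetric local cocycles are coboundaries. -/

section Harrison

variable {c : Cochain2 𝕜 A}

theorem cocycle_identity (hc : c ∈ localCocycle2 𝕜 A) (f g h : A) :
    f * c g h - c (f * g) h + c f (g * h) - c f g * h = 0 := by
  have := LinearMap.congr_fun (LinearMap.congr_fun (LinearMap.congr_fun
    (LinearMap.mem_ker.1 hc.2) f) g) h
  simpa using this

theorem localCoboundary2_le : localCoboundary2 𝕜 A ≤ localCocycle2 𝕜 A := by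
  rintro _ ⟨D, hD, rfl⟩
  exact ⟨hochschild1_mem_localCochain2 hD, LinearMap.mem_ker.2 (hochschild2_hochschild1 𝕜 A D)⟩

theorem hochschild1_symm (D : Cochain1 𝕜 A) (f g : A) :
    hochschild1 𝕜 A D f g = hochschild1 𝕜 A D g f := by
  simp [mul_comm]
  ring

theorem hochschild1_eq_comm (D : Cochain1 𝕜 A) (f : A) :
    hochschild1 𝕜 A D f = LinearMap.mulLeft 𝕜 (D f) - comm f D := by
  ext g
  simp
  ring

/-- The difference of the cocycle identities at `(a, b, f)` and `(b, a, f)`. It acts as the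
integrability condition for an operator whose commutators have the principal parts of the `c a`. -/
theorem comm_symm_cocycle (hc : c ∈ localCocycle2 𝕜 A) (hs : ∀ f g, c f g = c g f) (a b : A) :
    comm a (c b) = comm b (c a) := by
  ext f
  have h1 := cocycle_identity hc a b f
  have h2 := cocycle_identity hc b a f
  rw [mul_comm b a, hs b a] at h2
  simp only [comm_apply]
  linear_combination h2 - h1

/-- The order of a symmetric cocycle on the coordinates can be lowered by a coboundary. -/
theorem IsDualFrame.lower_order [CharZero 𝕜] (h : IsDualFrame x e) (hc : c ∈ localCocycle2 𝕜 A)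
    (hs : ∀ f g, c f g = c g f) {k : ℕ} (hk : 1 ≤ k) (hx : ∀ i, c (x i) ∈ orderLT 𝕜 A (k + 1)) :
    ∃ D ∈ localCochain1 𝕜 A, ∀ j, (c + hochschild1 𝕜 A D) (x j) ∈ orderLT 𝕜 A k := by
  -- Symmetry carries the bound from the coordinates to every `a`, since `comm (x i) (c a) = comm a
  -- (c (x i))`.
  have hca : ∀ a, c a ∈ orderLT 𝕜 A (k + 1) := fun a =>
    h.mem_orderLT_succ (hc.1.1 a) fun i => by
      rw [comm_symm_cocycle hc hs]
      exact DefQuant.mem_orderLT_succ.1 (hx i) a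
  have hmul : ∀ u, LinearMap.mulLeft 𝕜 u ∈ orderLT 𝕜 A k := fun u =>
    orderLT_mono hk (mulLeft_mem_orderLT u)
  -- As in the Poincaré lemma, contraction with the frame integrates `c`. In `comm (x j) G`, Euler's
  -- identity contributes `k` copies of `c (x j)` and differentiating the frame one more, whence the
  -- factor `(k + 1)⁻¹`. Multiplication operators are negligible because `1 ≤ k`.
  set G : Cochain1 𝕜 A := ∑ i, c (x i) ∘ₗ (e i : Cochain1 𝕜 A) with hG
  have hk0 : ((k + 1 : ℕ) : 𝕜) ≠ 0 := by exact_mod_cast k.succ_ne_zero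
  refine ⟨((k + 1 : ℕ) : 𝕜)⁻¹ • G, Submodule.smul_mem _ _ (Submodule.sum_mem _ fun i _ =>
    comp_mem_localCochain1 (hc.1.1 _) (derivation_mem_localCochain1 _)), fun j => ?_⟩
  have h1 := h.eulerOp_sub_mem_orderLT (hca (x j))
  have h2 := h.sub_sum_comp_mem_orderLT c hca (fun a b => by
    convert Submodule.sub_mem _ (DefQuant.mem_orderLT_succ.1 (hca a) b) (hmul (c a b)) using 1
    ext f
    have := cocycle_identity hc a b f
    simp only [LinearMap.sub_apply, LinearMap.comp_apply, LinearMap.mulLeft_apply, comm_apply]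
    linear_combination -this) (x j)
  have h3 : comm (x j) G - ((k + 1 : ℕ) : 𝕜) • c (x j) ∈ orderLT 𝕜 A k := by
    convert Submodule.add_mem _ h1 h2 using 1
    rw [hG, comm_sum_comp, eulerOp_apply]
    simp only [comm_symm_cocycle hc hs (x j), Nat.cast_succ, add_smul, one_smul]
    abel
  convert Submodule.sub_mem _ (hmul ((((k + 1 : ℕ) : 𝕜)⁻¹ • G) (x j)))
    (Submodule.smul_mem _ ((k + 1 : ℕ) : 𝕜)⁻¹ h3) using 1
  rw [LinearMap.add_apply, hochschild1_eq_comm, smul_sub, smul_smul, inv_mul_cancel₀ hk0, one_smul,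
    map_smul]
  abel

/-- A symmetric cocycle which has order zero on the coordinates is a coboundary. -/
theorem IsDualFrame.hochschild1_mulLeft_eq (h : IsDualFrame x e) (hc : c ∈ localCocycle2 𝕜 A)
    (hs : ∀ f g, c f g = c g f) (hx : ∀ i, c (x i) ∈ orderLT 𝕜 A 1) :
    hochschild1 𝕜 A (LinearMap.mulLeft 𝕜 (c 1 1)) = c := by
  have h1 : ∀ f, c f 1 = f * c 1 1 := fun f => by
    have := cocycle_identity hc f 1 1
    simp only [mul_one] at this
    linear_combination -this
  ext f g
  have hf : c f ∈ orderLT 𝕜 A 1 := by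
    obtain ⟨m, hm⟩ := mem_localCochain1.1 (hc.1.1 f)
    refine h.mem_orderLT_one_of_comm_eq_zero hm fun i => ?_
    rw [comm_symm_cocycle hc hs]
    exact mem_orderLT_zero.1 (DefQuant.mem_orderLT_succ.1 (hx i) f)
  have := mem_orderLT_one.1 hf g 1
  rw [mul_one, h1] at this
  rw [this]
  simp
  ring

/-- Symmetric local `2`-cocycles are coboundaries of differential operators. -/
theorem IsDualFrame.mem_localCoboundary2 [CharZero 𝕜] (h : IsDualFrame x e)
    (hc : c ∈ localCocycle2 𝕜 A) (hs : ∀ f g, c f g = c g f) : c ∈ localCoboundary2 𝕜 A := by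
  have hbound : ∃ k, ∀ i, c (x i) ∈ orderLT 𝕜 A (k + 1) := by
    choose m hm using fun i => mem_localCochain1.1 (hc.1.1 (x i))
    exact ⟨∑ i, m i, fun i => orderLT_mono ((Finset.single_le_sum (f := m)
      (fun _ _ => Nat.zero_le _) (Finset.mem_univ i)).trans (Nat.le_succ _)) (hm i)⟩
  obtain ⟨k, hk⟩ := hbound
  induction k generalizing c with
  | zero => exact ⟨_, mulLeft_mem_localCochain1 _, h.hochschild1_mulLeft_eq hc hs hk⟩
  | succ k ih =>
    obtain ⟨D, hD, hDx⟩ := h.lower_order hc hs (Nat.succ_pos k) hk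
    have hδ : hochschild1 𝕜 A D ∈ localCoboundary2 𝕜 A := ⟨D, hD, rfl⟩
    have := ih (Submodule.add_mem _ hc (localCoboundary2_le hδ))
      (fun f g => by
        rw [LinearMap.add_apply, LinearMap.add_apply, LinearMap.add_apply, LinearMap.add_apply,
          hs f g, hochschild1_symm D f g]) hDx
    convert sub_mem_of_cochain2 this hδ using 1
    ext f g
    simp only [LinearMap.add_apply, LinearMap.sub_apply]
    ring

end Harrison

end DualFrame

/-! ### The bivector field representing a local Hochschild class. -/

section HKR

variable {𝕜 A : Type*} [Field 𝕜] [CommRing A] [Algebra 𝕜 A] {c : Cochain2 𝕜 A}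

/-- The bivector field obtained by antisymmetrizing a local `2`-cocycle. -/
def antisymm (c : Cochain2 𝕜 A) (hc : c ∈ localCocycle2 𝕜 A) : Bivector 𝕜 A :=
  ⟨(2⁻¹ : 𝕜) • (c - c.flip), by
    refine ⟨fun f => by simp, fun f g h => ?_⟩
    -- The three identities move `f` past `g` and `h`; their alternating sum is the Leibniz rule.
    have h1 := cocycle_identity hc f g h
    have h2 := cocycle_identity hc g f h
    have h3 := cocycle_identity hc g h f
    rw [mul_comm g f] at h2
    rw [mul_comm h f] at h3
    simp only [LinearMap.smul_apply, LinearMap.sub_apply, LinearMap.flip_apply, mul_smul_comm,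
      ← smul_add]
    congr 1
    linear_combination h1 - h2 + h3⟩

@[simp] theorem antisymm_apply (hc : c ∈ localCocycle2 𝕜 A) (f g : A) :
    (antisymm c hc).1 f g = (2⁻¹ : 𝕜) • (c f g - c g f) := rfl

theorem eq_zero_of_eq_neg_self (𝕜 : Type*) {A : Type*} [Field 𝕜] [CharZero 𝕜] [AddCommGroup A]
    [Module 𝕜 A] {a : A} (h : a = -a) : a = 0 := by
  have h2 : (2 : 𝕜) • a = 0 := by rw [two_smul]; nth_rw 1 [h]; simp
  exact (smul_eq_zero_iff_right (two_ne_zero' 𝕜)).1 h2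

theorem hkr_eq_hochschildClass_iff {Ψ : Bivector 𝕜 A} (hc : c ∈ localCocycle2 𝕜 A) :
    hkr 𝕜 A Ψ = hochschildClass c hc ↔ Ψ.1 - c ∈ localCoboundary2 𝕜 A :=
  Submodule.Quotient.eq _

/-- Coboundaries of `1`-cochains are symmetric on a commutative algebra, while bivector fields are
skew. -/
theorem Bivector.eq_zero_of_mem_localCoboundary2 [CharZero 𝕜] {Ψ : Bivector 𝕜 A}
    (h : Ψ.1 ∈ localCoboundary2 𝕜 A) : Ψ = 0 := by
  obtain ⟨D, -, hD⟩ := h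
  ext f g
  refine eq_zero_of_eq_neg_self 𝕜 ?_
  rw [← Bivector.skew, ← hD]
  exact hochschild1_symm D f g

/-- The difference is minus the symmetric part of `c`, itself a symmetric local cocycle. -/
theorem antisymm_sub_mem_localCoboundary2 [CharZero 𝕜] {ι : Type*} [Fintype ι] {x : ι → A}
    {e : ι → Derivation 𝕜 A A} (h : IsDualFrame x e) (hc : c ∈ localCocycle2 𝕜 A) :
    (antisymm c hc).1 - c ∈ localCoboundary2 𝕜 A := by
  refine h.mem_localCoboundary2 (sub_mem_of_cochain2 (Bivector.mem_localCocycle2 _) hc)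
    fun f g => ?_
  simp only [LinearMap.sub_apply, antisymm_apply]
  have : ∀ a : A, (2⁻¹ : 𝕜) • a + (2⁻¹ : 𝕜) • a = a := fun a => by
    rw [← add_smul, ← two_mul, mul_inv_cancel₀ two_ne_zero, one_smul]
  have h1 := this (c f g - c g f)
  rw [← neg_sub (c f g) (c g f), smul_neg]
  linear_combination h1

theorem hkr_eq_hochschildClass_iff_eq_antisymm [CharZero 𝕜] {ι : Type*} [Fintype ι] {x : ι → A}
    {e : ι → Derivation 𝕜 A A} (h : IsDualFrame x e) (hc : c ∈ localCocycle2 𝕜 A)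
    (Ψ : Bivector 𝕜 A) :
    hkr 𝕜 A Ψ = hochschildClass c hc ↔ Ψ = antisymm c hc := by
  rw [hkr_eq_hochschildClass_iff]
  have h1 := antisymm_sub_mem_localCoboundary2 h hc
  constructor
  · intro h2
    rw [← sub_eq_zero]
    refine Bivector.eq_zero_of_mem_localCoboundary2 ?_
    convert sub_mem_of_cochain2 h2 h1 using 1
    ext f g
    change Ψ.1 f g - (antisymm c hc).1 f g = _
    simp only [LinearMap.sub_apply]
    ring
  · rintro rfl
    exact h1

end HKR

/-! ### Differentiation under the integral sign. -/

section ParametricIntegral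

open MeasureTheory Set

variable {E : Type*} [NormedAddCommGroup E] [NormedSpace ℝ E] [FiniteDimensional ℝ E]

theorem hasFDerivAt_intervalIntegral_of_contDiff {F : Type*} [NormedAddCommGroup F]
    [NormedSpace ℝ F] {G : E × ℝ → F} (hG : ContDiff ℝ 1 G) (x₀ : E) :
    HasFDerivAt (fun x => ∫ t in (0 : ℝ)..1, G (x, t))
      (∫ t in (0 : ℝ)..1, (fderiv ℝ G (x₀, t)).comp (ContinuousLinearMap.inl ℝ E ℝ)) x₀ := by
  have hcont : Continuous fun p : E × ℝ =>
      (fderiv ℝ G p).comp (ContinuousLinearMap.inl ℝ E ℝ) :=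
    (hG.continuous_fderiv one_ne_zero).clm_comp continuous_const
  -- Compactness of ball times interval supplies a constant dominating function.
  obtain ⟨C, hC⟩ := ((isCompact_closedBall x₀ 1).prod (isCompact_Icc (a := (0 : ℝ)) (b := 1))
    ).exists_bound_of_continuousOn hcont.continuousOn
  refine intervalIntegral.hasFDerivAt_integral_of_dominated_of_fderiv_le (bound := fun _ => C)
    (F' := fun x t => (fderiv ℝ G (x, t)).comp (ContinuousLinearMap.inl ℝ E ℝ))
    (Metric.ball_mem_nhds x₀ one_pos) ?_ ?_ ?_ ?_ ?_ ?_
  · exact Filter.Eventually.of_forall fun x =>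
      (hG.continuous.comp (by fun_prop)).aestronglyMeasurable
  · exact (hG.continuous.comp
      (by fun_prop : Continuous fun t : ℝ => (x₀, t))).intervalIntegrable _ _
  · exact (hcont.comp (by fun_prop : Continuous fun t : ℝ => (x₀, t))).aestronglyMeasurable
  · refine Filter.Eventually.of_forall fun t ht x hx =>
      hC (x, t) ⟨Metric.ball_subset_closedBall hx, ?_⟩
    rw [uIoc_of_le zero_le_one] at ht
    exact Ioc_subset_Icc_self ht
  · exact intervalIntegrable_const
  · refine Filter.Eventually.of_forall fun t _ x _ => ?_
    have h1 : HasFDerivAt G (fderiv ℝ G (x, t)) (x, t) :=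
      (hG.differentiable one_ne_zero _).hasFDerivAt
    exact h1.comp x (hasFDerivAt_prodMk_left x t)

end ParametricIntegral

/-! ### Smooth parametric integrals and Hadamard's lemma. -/

section Hadamard

universe u

variable {E : Type} [NormedAddCommGroup E] [NormedSpace ℝ E] [FiniteDimensional ℝ E]

/-- The derivative is an integral of the same kind with values in `E →L[ℝ] F`, so the induction
varies `F`. Having `E` in `Type` keeps these spaces in the universe of `F`. -/
theorem contDiff_intervalIntegral_nat (n : ℕ) {F : Type u} [NormedAddCommGroup F]
    [NormedSpace ℝ F] {G : E × ℝ → F} (hG : ContDiff ℝ ∞ G) :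
    ContDiff ℝ n fun x => ∫ t in (0 : ℝ)..1, G (x, t) := by
  have hd : ∀ {F : Type u} [NormedAddCommGroup F] [NormedSpace ℝ F] {G : E × ℝ → F},
      ContDiff ℝ ∞ G → ∀ x₀, _ := fun hG x₀ =>
    hasFDerivAt_intervalIntegral_of_contDiff (hG.of_le (by exact_mod_cast le_top)) x₀
  induction n generalizing F with
  | zero =>
    exact contDiff_zero.2 (continuous_iff_continuousAt.2 fun x => (hd hG x).continuousAt)
  | succ n ih =>
    rw [Nat.cast_succ, contDiff_succ_iff_fderiv]
    refine ⟨fun x => (hd hG x).differentiableAt, by simp, ?_⟩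
    rw [funext fun x => (hd hG x).fderiv]
    exact ih (G := fun p => (fderiv ℝ G p).comp (ContinuousLinearMap.inl ℝ E ℝ))
      ((hG.fderiv_right (m := ∞) (by simp)).clm_comp contDiff_const)

theorem contDiff_intervalIntegral {F : Type u} [NormedAddCommGroup F]
    [NormedSpace ℝ F] {G : E × ℝ → F} (hG : ContDiff ℝ ∞ G) :
    ContDiff ℝ ∞ fun x => ∫ t in (0 : ℝ)..1, G (x, t) :=
  contDiff_infty.2 fun n => contDiff_intervalIntegral_nat n hG

/-- Hadamard's lemma. -/
theorem exists_contDiff_sub_eq_sum {d : ℕ} {F : Type u} [NormedAddCommGroup F] [NormedSpace ℝ F]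
    [CompleteSpace F] {f : EuclideanSpace ℝ (Fin d) → F} (hf : ContDiff ℝ ∞ f)
    (y : EuclideanSpace ℝ (Fin d)) :
    ∃ h : Fin d → EuclideanSpace ℝ (Fin d) → F, (∀ i, ContDiff ℝ ∞ (h i)) ∧
      (∀ i, h i y = fderiv ℝ f y (EuclideanSpace.single i 1)) ∧
      ∀ x, f x - f y = ∑ i, (x i - y i) • h i x := by
  have hf1 : ContDiff ℝ 1 f := hf.of_le (by exact_mod_cast le_top)
  refine ⟨fun i x => ∫ t in (0 : ℝ)..1,
    fderiv ℝ f (y + t • (x - y)) (EuclideanSpace.single i 1),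
    fun i => ?_, fun i => ?_, fun x => ?_⟩
  · refine contDiff_intervalIntegral (G := fun p : EuclideanSpace ℝ (Fin d) × ℝ =>
      fderiv ℝ f (y + p.2 • (p.1 - y)) (EuclideanSpace.single i 1)) ?_
    refine ContDiff.clm_apply ?_ contDiff_const
    exact (hf.fderiv_right (m := ∞) (by simp)).comp
      (contDiff_const.add (contDiff_snd.smul (contDiff_fst.sub contDiff_const)))
  · simp
  · have hcont : ∀ v, Continuous fun t : ℝ => fderiv ℝ f (y + t • (x - y)) v := fun v =>
      ((hf1.continuous_fderiv one_ne_zero).comp (by fun_prop)).clm_apply continuous_const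
    have hder : ∀ t : ℝ, HasDerivAt (fun t : ℝ => f (y + t • (x - y)))
        (fderiv ℝ f (y + t • (x - y)) (x - y)) t := fun t => by
      have h1 : HasDerivAt (fun t : ℝ => y + t • (x - y)) (x - y) t := by
        simpa using ((hasDerivAt_id t).smul_const (x - y)).const_add y
      exact ((hf1.differentiable one_ne_zero _).hasFDerivAt).comp_hasDerivAt t h1
    have hint := intervalIntegral.integral_eq_sub_of_hasDerivAt (a := 0) (b := 1)
      (fun t _ => hder t) ((hcont _).intervalIntegrable _ _)
    simp only [one_smul, zero_smul, add_zero, add_sub_cancel] at hint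
    rw [← hint]
    simp only [← intervalIntegral.integral_smul]
    refine Eq.trans (intervalIntegral.integral_congr fun t _ => ?_)
      (intervalIntegral.integral_finsetSum (f := fun i t =>
        (x i - y i) • fderiv ℝ f (y + t • (x - y)) (EuclideanSpace.single i 1)) fun i _ =>
          ((hcont _).const_smul (x i - y i)).intervalIntegrable _ _)
    have hxy : x - y = ∑ i, (x i - y i) • EuclideanSpace.single i (1 : ℝ) := by
      ext j
      simp [Finset.sum_apply, Pi.single_apply]
    nth_rw 2 [hxy]
    simp

end Hadamard

/-! ### Frames with weights, in place of a partition of unity. -/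

section FrameIdeal

variable (𝕜 A : Type*) [Field 𝕜] [CommRing A] [Algebra 𝕜 A]

/-- The functions `ρ` such that `ρ Y = ∑ Y(xᵢ) ∂ᵢ` for all derivations `Y`, with suitable
functions `xᵢ` and derivations `∂ᵢ`. -/
def frameIdeal : Ideal A where
  carrier := {ρ | ∃ (n : ℕ) (x : Fin n → A) (e : Fin n → Derivation 𝕜 A A),
    ∀ (Y : Derivation 𝕜 A A) (f : A), ρ * Y f = ∑ i, Y (x i) * e i f}
  zero_mem' := ⟨0, Fin.elim0, Fin.elim0, by simp⟩
  add_mem' := by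
    rintro ρ σ ⟨m, x, e, h⟩ ⟨n, y, e', h'⟩
    refine ⟨m + n, Fin.append x y, Fin.append e e', fun Y f => ?_⟩
    simp [Fin.sum_univ_add, add_mul, h, h']
  smul_mem' := by
    rintro a ρ ⟨m, x, e, h⟩
    refine ⟨m, x, fun i => a • e i, fun Y f => ?_⟩
    simp only [smul_eq_mul, mul_assoc, h, Finset.mul_sum, Derivation.smul_apply]
    exact Finset.sum_congr rfl fun i _ => mul_left_comm _ _ _

variable {𝕜 A}

theorem exists_isDualFrame_of_frameIdeal_eq_top (h : frameIdeal 𝕜 A = ⊤) :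
    ∃ (n : ℕ) (x : Fin n → A) (e : Fin n → Derivation 𝕜 A A), IsDualFrame x e := by
  obtain ⟨n, x, e, he⟩ := (Ideal.eq_top_iff_one _).1 h
  exact ⟨n, x, e, fun Y f => by simpa using he Y f⟩

end FrameIdeal

/-! ### A dual frame on a compact manifold. -/

section Manifold

open Set Topology Filter

variable {𝕜 : Type*} [RCLike 𝕜] {d : ℕ} {M : Type*} [TopologicalSpace M]
  [ChartedSpace (EuclideanSpace ℝ (Fin d)) M]

/-- Evaluation of smooth functions at a point. -/
def evalAt (q : M) : SmoothFunctions 𝕜 d M →ₐ[𝕜] 𝕜 :=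
  (Pi.evalAlgHom 𝕜 (fun _ : M => 𝕜) q).comp (SmoothFunctions 𝕜 d M).val

theorem evalAt_apply (q : M) (f : SmoothFunctions 𝕜 d M) : evalAt q f = f.1 q := rfl

theorem smoothFunctions_ext {f g : SmoothFunctions 𝕜 d M} (h : ∀ q, evalAt q f = evalAt q g) :
    f = g := Subtype.ext (funext h)

theorem isUnit_of_evalAt_ne_zero {f : SmoothFunctions 𝕜 d M} (hf : ∀ q, evalAt q f ≠ 0) :
    IsUnit f := by
  refine IsUnit.of_mul_eq_one ⟨fun q => (f.1 q)⁻¹, fun q => ?_⟩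
    (smoothFunctions_ext fun q => mul_inv_cancel₀ (hf q))
  have hfq : f.1 q ≠ 0 := hf q
  have hf' : ContMDiffAt (𝓡 d) 𝓘(ℝ, 𝕜) ∞ f.1 q := f.2 q
  exact (contDiffAt_inv ℝ hfq).contMDiffAt.comp q hf'

theorem contMDiff_smul_of_tsupport_subset {ρ : M → ℝ} (hρ : ContMDiff (𝓡 d) 𝓘(ℝ, ℝ) ∞ ρ)
    {U : Set M} (hU : IsOpen U) (hρU : tsupport ρ ⊆ U) {g : M → 𝕜}
    (hg : ContMDiffOn (𝓡 d) 𝓘(ℝ, 𝕜) ∞ g U) :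
    ContMDiff (𝓡 d) 𝓘(ℝ, 𝕜) ∞ fun q => ρ q • g q := by
  refine contMDiff_of_tsupport fun q hq => ?_
  have hqU := hρU (tsupport_smul_subset_left _ _ hq)
  exact (hρ q).smul ((hg q hqU).contMDiffAt (hU.mem_nhds hqU))

variable [IsManifold (𝓡 d) ∞ M]

theorem contDiffOn_comp_extChartAt_symm (p : M) (f : SmoothFunctions 𝕜 d M) :
    ContDiffOn ℝ ∞ (f.1 ∘ (extChartAt (𝓡 d) p).symm) (extChartAt (𝓡 d) p).target := by
  rw [← contMDiffOn_iff_contDiffOn]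
  exact (show ContMDiff (𝓡 d) 𝓘(ℝ, 𝕜) ∞ f.1 from f.2).comp_contMDiffOn
    (contMDiffOn_extChartAt_symm p)

theorem differentiableAt_comp_extChartAt_symm {p q : M}
    (hq : q ∈ (chartAt (EuclideanSpace ℝ (Fin d)) p).source) (f : SmoothFunctions 𝕜 d M) :
    DifferentiableAt ℝ (f.1 ∘ (extChartAt (𝓡 d) p).symm) (extChartAt (𝓡 d) p q) := by
  refine ((contDiffOn_comp_extChartAt_symm p f).contDiffAt
    ((isOpen_extChartAt_target p).mem_nhds ?_)).differentiableAt (by simp)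
  exact (extChartAt (𝓡 d) p).map_source (by rwa [extChartAt_source])

theorem contMDiffOn_fderiv_comp_extChartAt_symm (p : M) (f : SmoothFunctions 𝕜 d M)
    (v : EuclideanSpace ℝ (Fin d)) :
    ContMDiffOn (𝓡 d) 𝓘(ℝ, 𝕜) ∞
      (fun q => fderiv ℝ (f.1 ∘ (extChartAt (𝓡 d) p).symm) (extChartAt (𝓡 d) p q) v)
      (chartAt (EuclideanSpace ℝ (Fin d)) p).source := by
  have h1 : ContDiffOn ℝ ∞ (fun z => fderiv ℝ (f.1 ∘ (extChartAt (𝓡 d) p).symm) z v)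
      (extChartAt (𝓡 d) p).target :=
    ((contDiffOn_comp_extChartAt_symm p f).fderiv_of_isOpen (isOpen_extChartAt_target p)
      (m := ∞) (by simp)).clm_apply contDiffOn_const
  refine (contMDiffOn_iff_contDiffOn.2 h1).comp (contMDiffOn_extChartAt (x := p)) fun q hq => ?_
  exact (extChartAt (𝓡 d) p).map_source (by rwa [extChartAt_source])

theorem contMDiffOn_coord (p : M) (i : Fin d) :
    ContMDiffOn (𝓡 d) 𝓘(ℝ, 𝕜) ∞ (fun q => ((extChartAt (𝓡 d) p q i : ℝ) : 𝕜))
      (chartAt (EuclideanSpace ℝ (Fin d)) p).source := by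
  have h1 : ContDiff ℝ ∞ fun z : EuclideanSpace ℝ (Fin d) => ((z i : ℝ) : 𝕜) :=
    (RCLike.ofRealCLM (K := 𝕜)).contDiff.comp (EuclideanSpace.proj (𝕜 := ℝ) i).contDiff
  exact h1.contMDiff.comp_contMDiffOn (contMDiffOn_extChartAt (x := p))

variable [T2Space M]

/-- The coordinate functions of the chart at `p`, cut off. -/
noncomputable def cutoffCoord {p : M} (χ : SmoothBumpFunction (𝓡 d) p) (i : Fin d) :
    SmoothFunctions 𝕜 d M :=
  ⟨fun q => χ q • ((extChartAt (𝓡 d) p q i : ℝ) : 𝕜),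
    contMDiff_smul_of_tsupport_subset χ.contMDiff (chartAt _ p).open_source
      χ.tsupport_subset_chartAt_source (contMDiffOn_coord p i)⟩

/-- The coordinate vector fields of the chart at `p`, cut off. -/
noncomputable def cutoffField {p : M} (ρ : SmoothBumpFunction (𝓡 d) p) (i : Fin d) :
    Derivation 𝕜 (SmoothFunctions 𝕜 d M) (SmoothFunctions 𝕜 d M) :=
  have hsrc : ∀ {q}, ρ q ≠ 0 → q ∈ (chartAt (EuclideanSpace ℝ (Fin d)) p).source :=
    fun h => ρ.support_subset_source h
  Derivation.mk'
    { toFun := fun f => ⟨fun q => ρ q • fderiv ℝ (f.1 ∘ (extChartAt (𝓡 d) p).symm)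
          (extChartAt (𝓡 d) p q) (EuclideanSpace.single i 1),
        contMDiff_smul_of_tsupport_subset ρ.contMDiff (chartAt _ p).open_source
          ρ.tsupport_subset_chartAt_source (contMDiffOn_fderiv_comp_extChartAt_symm p f _)⟩
      map_add' := fun f g => Subtype.ext <| funext fun q => by
        by_cases hq : ρ q = 0
        · simp [hq]
        · have := fderiv_add (differentiableAt_comp_extChartAt_symm (hsrc hq) f)
            (differentiableAt_comp_extChartAt_symm (hsrc hq) g)
          change ρ q • fderiv ℝ ((f.1 ∘ (extChartAt (𝓡 d) p).symm) +
            (g.1 ∘ (extChartAt (𝓡 d) p).symm)) _ _ = ρ q • _ + ρ q • _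
          rw [this, add_apply, smul_add]
      map_smul' := fun c f => Subtype.ext <| funext fun q => by
        by_cases hq : ρ q = 0
        · simp [hq]
        · have := fderiv_const_smul (differentiableAt_comp_extChartAt_symm (hsrc hq) f) c
          change ρ q • fderiv ℝ (c • (f.1 ∘ (extChartAt (𝓡 d) p).symm)) _ _ = c • (ρ q • _)
          rw [this, smul_apply, smul_comm] }
    (fun f g => Subtype.ext <| funext fun q => by
      by_cases hq : ρ q = 0
      · simp [hq]
      · have := fderiv_mul (differentiableAt_comp_extChartAt_symm (hsrc hq) f)
          (differentiableAt_comp_extChartAt_symm (hsrc hq) g)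
        have hinv : (extChartAt (𝓡 d) p).symm (extChartAt (𝓡 d) p q) = q :=
          (extChartAt (𝓡 d) p).left_inv (by rw [extChartAt_source]; exact hsrc hq)
        change ρ q • fderiv ℝ ((f.1 ∘ (extChartAt (𝓡 d) p).symm) *
          (g.1 ∘ (extChartAt (𝓡 d) p).symm)) _ _ = f.1 q * (ρ q • _) + g.1 q * (ρ q • _)
        rw [this, add_apply, smul_add, smul_apply,
          smul_apply, Function.comp_apply, Function.comp_apply, hinv,
          smul_eq_mul, smul_eq_mul, mul_smul_comm, mul_smul_comm])

theorem cutoffField_apply {p : M} (ρ : SmoothBumpFunction (𝓡 d) p) (i : Fin d)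
    (f : SmoothFunctions 𝕜 d M) (q : M) :
    (cutoffField (𝕜 := 𝕜) ρ i f).1 q = ρ q • fderiv ℝ (f.1 ∘ (extChartAt (𝓡 d) p).symm)
      (extChartAt (𝓡 d) p q) (EuclideanSpace.single i 1) := rfl

/-- Derivations of the algebra of smooth functions in local coordinates. -/
theorem derivation_apply_eq_sum {p q : M} (χ : SmoothBumpFunction (𝓡 d) p)
    (hq : q ∈ (chartAt (EuclideanSpace ℝ (Fin d)) p).source) (hχ : ∀ᶠ q' in 𝓝 q, χ q' = 1)
    (Y : Derivation 𝕜 (SmoothFunctions 𝕜 d M) (SmoothFunctions 𝕜 d M))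
    (f : SmoothFunctions 𝕜 d M) :
    (Y f).1 q = ∑ i, (Y (cutoffCoord χ i)).1 q * fderiv ℝ (f.1 ∘ (extChartAt (𝓡 d) p).symm)
      (extChartAt (𝓡 d) p q) (EuclideanSpace.single i 1) := by
  set φ := extChartAt (𝓡 d) p with hφ
  have hqs : q ∈ φ.source := by rwa [hφ, extChartAt_source]
  have htarget : φ.target ∈ 𝓝 (φ q) :=
    (isOpen_extChartAt_target p).mem_nhds (φ.map_source hqs)
  -- extend `f` in the chart to a smooth function on the whole space
  obtain ⟨r, hr, hrt⟩ := Metric.nhds_basis_closedBall.mem_iff.1 htarget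
  let b : ContDiffBump (φ q) := ⟨r / 2, r, half_pos hr, half_lt_self hr⟩
  have hF : ContDiff ℝ ∞ fun z => b z • f.1 (φ.symm z) := by
    refine contDiff_iff_contDiffAt.2 fun z => ?_
    by_cases hz : z ∈ φ.target
    · exact b.contDiff.contDiffAt.smul ((contDiffOn_comp_extChartAt_symm p f).contDiffAt
        ((isOpen_extChartAt_target p).mem_nhds hz))
    · have hz' : z ∉ tsupport b := by
        rw [b.tsupport_eq]
        exact fun h => hz (hrt h)
      refine contDiffAt_const (c := (0 : 𝕜)) |>.congr_of_eventuallyEq ?_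
      filter_upwards [notMem_tsupport_iff_eventuallyEq.1 hz'] with w hw
      simp [hw]
  obtain ⟨h, hh, hhq, hsum⟩ := exists_contDiff_sub_eq_sum hF (φ q)
  have hFf : (fun z => b z • f.1 (φ.symm z)) =ᶠ[𝓝 (φ q)] f.1 ∘ φ.symm := by
    filter_upwards [b.eventuallyEq_one] with z hz
    simp [hz]
  have hb : ∀ᶠ q' in 𝓝 q, b (φ q') = 1 :=
    (continuousAt_extChartAt' hqs).eventually b.eventuallyEq_one
  -- a cutoff function on the manifold
  have hs : (chartAt (EuclideanSpace ℝ (Fin d)) p).source ∩ {q' | χ q' = 1 ∧ b (φ q') = 1}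
      ∈ 𝓝 q := inter_mem ((chartAt _ p).open_source.mem_nhds hq) (hχ.and hb)
  obtain ⟨ψ, -, hψ⟩ := (SmoothBumpFunction.nhds_basis_tsupport (I := 𝓡 d) q).mem_iff.1 hs
  have hψsm : ∀ {g : M → 𝕜}, ContMDiffOn (𝓡 d) 𝓘(ℝ, 𝕜) ∞ g
      (chartAt (EuclideanSpace ℝ (Fin d)) p).source →
      ContMDiff (𝓡 d) 𝓘(ℝ, 𝕜) ∞ fun q' => ψ q' • g q' := fun hg =>
    contMDiff_smul_of_tsupport_subset ψ.contMDiff (chartAt _ p).open_source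
      (fun x hx => (hψ hx).1) hg
  let Ψ : SmoothFunctions 𝕜 d M := ⟨fun q' => ψ q' • (1 : 𝕜), hψsm contMDiffOn_const⟩
  let H : Fin d → SmoothFunctions 𝕜 d M := fun i => ⟨fun q' => ψ q' • h i (φ q'), hψsm
    ((hh i).contMDiff.comp_contMDiffOn (contMDiffOn_extChartAt (x := p)))⟩
  have hΨ : ∀ q', evalAt q' Ψ = (ψ q' : 𝕜) := fun q' =>
    (RCLike.real_smul_eq_coe_mul _ _).trans (mul_one _)
  have hH : ∀ i q', evalAt q' (H i) = (ψ q' : 𝕜) * h i (φ q') := fun i q' =>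
    RCLike.real_smul_eq_coe_mul _ _
  have hx : ∀ i q', χ q' = 1 → evalAt q' (cutoffCoord (𝕜 := 𝕜) χ i) = (φ q' i : ℝ) :=
    fun i q' h1 => by
      change χ q' • ((extChartAt (𝓡 d) p q' i : ℝ) : 𝕜) = _
      rw [h1, one_smul]
  have hq1 : χ q = 1 := hχ.self_of_nhds
  have hψq : ψ q = 1 := ψ.eq_one
  -- Hadamard's formula becomes an identity of global functions: both sides vanish where `ψ` does,
  -- and where `ψ` is nonzero both `χ` and `b ∘ φ` equal `1`. Applying `Y` and evaluating at `q`
  -- then needs only the Leibniz rule, with no separate proof that `Y` is local.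
  have key : Ψ * Ψ * (f - algebraMap 𝕜 _ (evalAt q f)) =
      ∑ i, Ψ * (cutoffCoord χ i - algebraMap 𝕜 _ (evalAt q (cutoffCoord χ i))) * H i := by
    refine smoothFunctions_ext fun q' => ?_
    simp only [map_sum, map_mul, map_sub, AlgHom.commutes, Algebra.algebraMap_self,
      RingHom.id_apply, hΨ, hH, hx _ q hq1]
    by_cases h0 : ψ q' = 0
    · simp [h0]
    obtain ⟨hq's, hq'1, hq'b⟩ := hψ (subset_tsupport _ h0)
    have hq's' : q' ∈ φ.source := by rwa [hφ, extChartAt_source]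
    have h1 := hsum (φ q')
    simp only [hq'b, hb.self_of_nhds, one_smul, φ.left_inv hq's', φ.left_inv hqs] at h1
    simp only [hx _ q' hq'1, evalAt_apply, h1, Finset.mul_sum, RCLike.real_smul_eq_coe_mul,
      RCLike.ofReal_sub]
    exact Finset.sum_congr rfl fun i _ => by ring
  have hY := congrArg (fun g => evalAt q (Y g)) key
  simp only [map_sum, Derivation.leibniz, map_sub, Derivation.map_algebraMap, smul_eq_mul, map_add,
    map_mul, AlgHom.commutes, Algebra.algebraMap_self, RingHom.id_apply, sub_self, zero_mul,
    mul_zero, add_zero, sub_zero, hΨ, hH, hψq, RCLike.ofReal_one, one_mul, zero_add, hhq,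
    hFf.fderiv_eq] at hY
  rw [← evalAt_apply, hY]
  exact Finset.sum_congr rfl fun i _ => mul_comm _ _

/-- A bump function supported where `χ` is locally constant equal to `1` turns the coordinate
formula for derivations into a global one. Its nonnegativity is recorded so that finite sums of such
weights cannot cancel. -/
theorem exists_mem_frameIdeal (p : M) :
    ∃ ρ ∈ frameIdeal 𝕜 (SmoothFunctions 𝕜 d M), ∃ r : M → ℝ, (∀ q, 0 ≤ r q) ∧ 0 < r p ∧
      ∀ q, evalAt q ρ = (r q : 𝕜) := by
  obtain ⟨χ⟩ : Nonempty (SmoothBumpFunction (𝓡 d) p) := inferInstance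
  have hs : {q | ∀ᶠ q' in 𝓝 q, χ q' = 1} ∈ 𝓝 p := eventually_eventually_nhds.2 χ.eventuallyEq_one
  obtain ⟨ρ, -, hρ⟩ := (SmoothBumpFunction.nhds_basis_support (I := 𝓡 d) hs).mem_iff.1 hs
  let R : SmoothFunctions 𝕜 d M := ⟨fun q => ρ q • (1 : 𝕜),
    contMDiff_smul_of_tsupport_subset ρ.contMDiff isOpen_univ (subset_univ _) contMDiffOn_const⟩
  have hR : ∀ q, evalAt q R = (ρ q : 𝕜) := fun q =>
    (RCLike.real_smul_eq_coe_mul _ _).trans (mul_one _)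
  refine ⟨R, ⟨d, cutoffCoord χ, cutoffField ρ, fun Y f => smoothFunctions_ext fun q => ?_⟩, ρ,
    fun q => ρ.nonneg, by rw [ρ.eq_one]; exact one_pos, hR⟩
  simp only [map_mul, map_sum, hR, evalAt_apply, cutoffField_apply]
  by_cases h0 : ρ q = 0
  · simp [h0]
  · rw [derivation_apply_eq_sum χ (ρ.support_subset_source h0) (hρ h0) Y f, Finset.mul_sum]
    refine Finset.sum_congr rfl fun i _ => ?_
    rw [RCLike.real_smul_eq_coe_mul]
    ring

variable (𝕜 d M) in
-- By compactness finitely many weights have a nowhere vanishing sum, which is a unit lying in the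
-- ideal.
theorem frameIdeal_smoothFunctions_eq_top [CompactSpace M] :
    frameIdeal 𝕜 (SmoothFunctions 𝕜 d M) = ⊤ := by
  choose ρ hρ r hr hrp hρr using fun p : M => exists_mem_frameIdeal (𝕜 := 𝕜) (d := d) p
  have hcont : ∀ p, Continuous (r p) := fun p => by
    have h1 : Continuous fun q => RCLike.re ((ρ p).1 q) :=
      RCLike.continuous_re.comp (show ContMDiff (𝓡 d) 𝓘(ℝ, 𝕜) ∞ (ρ p).1 from (ρ p).2).continuous
    convert h1 using 2 with q
    rw [← evalAt_apply, hρr, RCLike.ofReal_re]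
  obtain ⟨t, ht⟩ := isCompact_univ.elim_finite_subcover (fun p => {q | 0 < r p q})
    (fun p => isOpen_lt continuous_const (hcont p)) fun p _ => mem_iUnion.2 ⟨p, hrp p⟩
  refine Ideal.eq_top_of_isUnit_mem _ (Ideal.sum_mem _ fun p (_ : p ∈ t) => hρ p)
    (isUnit_of_evalAt_ne_zero fun q => ?_)
  obtain ⟨p, hp, hpq⟩ := mem_iUnion₂.1 (ht (mem_univ q))
  rw [map_sum, Finset.sum_congr rfl fun p _ => hρr p q, ← RCLike.ofReal_sum]
  exact_mod_cast (Finset.sum_pos' (fun p _ => hr p q) ⟨p, hp, hpq⟩).ne'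

variable (𝕜 d M) in
theorem exists_isDualFrame_smoothFunctions [CompactSpace M] :
    ∃ (n : ℕ) (x : Fin n → SmoothFunctions 𝕜 d M)
      (e : Fin n → Derivation 𝕜 (SmoothFunctions 𝕜 d M) (SmoothFunctions 𝕜 d M)),
      IsDualFrame x e :=
  exists_isDualFrame_of_frameIdeal_eq_top (frameIdeal_smoothFunctions_eq_top 𝕜 d M)

end Manifold

/-! ### Coefficients of the star product and of the derivation defect. -/

section StarProducts

open Finset.HasAntidiagonal PowerSeries

variable {𝕜 A : Type*} [Field 𝕜] [CommRing A] [Algebra 𝕜 A]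

theorem sum_antidiagonal_antidiagonal {N : Type*} [AddCommMonoid N] (F : ℕ → ℕ → ℕ → N) (m : ℕ) :
    ∑ p ∈ antidiagonal m, ∑ q ∈ antidiagonal p.2, F p.1 q.1 q.2 =
      ∑ p ∈ antidiagonal m, ∑ q ∈ antidiagonal p.1, F q.1 q.2 p.2 := by
  rw [Finset.sum_sigma', Finset.sum_sigma']
  refine Finset.sum_nbij' (fun p => ⟨(p.1.1 + p.2.1, p.2.2), (p.1.1, p.2.1)⟩)
    (fun p => ⟨(p.2.1, p.2.2 + p.1.2), (p.2.2, p.1.2)⟩) ?_ ?_ ?_ ?_ ?_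
  · rintro ⟨⟨a, b⟩, ⟨c, e⟩⟩ h
    simp at h ⊢
    omega
  · rintro ⟨⟨a, b⟩, ⟨c, e⟩⟩ h
    simp at h ⊢
    omega
  · rintro ⟨⟨a, b⟩, ⟨c, e⟩⟩ h
    simp at h
    obtain ⟨h1, rfl⟩ := h
    rfl
  · rintro ⟨⟨a, b⟩, ⟨c, e⟩⟩ h
    simp at h
    obtain ⟨h1, rfl⟩ := h
    rfl
  · rintro ⟨⟨a, b⟩, ⟨c, e⟩⟩ h
    rfl

theorem sum_antidiagonal_of_ne_fst {N : Type*} [AddCommMonoid N] {F : ℕ → ℕ → N} {m : ℕ}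
    (h : ∀ i j, i ≠ 0 → F i j = 0) : ∑ q ∈ antidiagonal m, F q.1 q.2 = F 0 m := by
  refine Finset.sum_eq_single_of_mem (0, m) (by simp) fun q _ hq' => h _ _ fun h0 => hq' ?_
  simp_all [Prod.ext_iff]

theorem sum_antidiagonal_of_ne_snd {N : Type*} [AddCommMonoid N] {F : ℕ → ℕ → N} {m : ℕ}
    (h : ∀ i j, j ≠ 0 → F i j = 0) : ∑ q ∈ antidiagonal m, F q.1 q.2 = F m 0 := by
  refine Finset.sum_eq_single_of_mem (m, 0) (by simp) fun q _ hq' => h _ _ fun h0 => hq' ?_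
  simp_all [Prod.ext_iff]

variable (B : ℕ → Cochain2 𝕜 A) (X : ℕ → Cochain1 𝕜 A)

theorem coeff_starMul_C_right (a : PowerSeries A) (g : A) (m : ℕ) :
    coeff m (starMul B a (C g)) = ∑ p ∈ antidiagonal m, B p.1 (coeff p.2 a) g := by
  rw [starMul, coeff_mk]
  refine Finset.sum_congr rfl fun p _ => ?_
  rw [sum_antidiagonal_of_ne_snd (F := fun i j => B p.1 (coeff i a) (coeff j (C g)))]
  · simp
  · intro i j hj
    simp [coeff_C, hj]

theorem coeff_starMul_C_left (f : A) (b : PowerSeries A) (m : ℕ) :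
    coeff m (starMul B (C f) b) = ∑ p ∈ antidiagonal m, B p.1 f (coeff p.2 b) := by
  rw [starMul, coeff_mk]
  refine Finset.sum_congr rfl fun p _ => ?_
  rw [sum_antidiagonal_of_ne_fst (F := fun i j => B p.1 (coeff i (C f)) (coeff j b))]
  · simp
  · intro i j hj
    simp [coeff_C, hj]

theorem coeff_starMul_C_C (f g : A) (m : ℕ) : coeff m (starMul B (C f) (C g)) = B m f g := by
  rw [coeff_starMul_C_left,
    sum_antidiagonal_of_ne_snd (F := fun i j => B i f (coeff j (C g)))]
  · simp
  · intro i j hj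
    simp [coeff_C, hj]

theorem coeff_formalOp (a : PowerSeries A) (m : ℕ) :
    coeff m (formalOp X a) = ∑ p ∈ antidiagonal m, X p.1 (coeff p.2 a) := by
  rw [formalOp, coeff_mk]

theorem coeff_formalOp_C (f : A) (m : ℕ) : coeff m (formalOp X (C f)) = X m f := by
  rw [coeff_formalOp, sum_antidiagonal_of_ne_snd (F := fun i j => X i (coeff j (C f)))]
  · simp
  · intro i j hj
    simp [coeff_C, hj]

namespace StarProduct

variable {P : Poisson 𝕜 A} (S : StarProduct P)

theorem sum_assoc (f g h : A) (m : ℕ) :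
    ∑ p ∈ antidiagonal m, (S.B p.1 (S.B p.2 f g) h - S.B p.1 f (S.B p.2 g h)) = 0 := by
  have h1 := congrArg (coeff m) (S.assoc f g h)
  rw [coeff_starMul_C_right, coeff_starMul_C_left] at h1
  simp only [coeff_starMul_C_C] at h1
  rw [Finset.sum_sub_distrib, h1, sub_self]

/-- The coefficient of `ħᵐ` in `(f, g) ↦ 𝒳(f) ∗ g + f ∗ 𝒳(g) - 𝒳(f ∗ g)`. -/
def defect (m : ℕ) : Cochain2 𝕜 A :=
  ∑ p ∈ antidiagonal m, gerstenhaber (S.B p.1) (X p.2)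

theorem defect_apply (m : ℕ) (f g : A) : S.defect X m f g = ∑ p ∈ antidiagonal m,
    (S.B p.1 (X p.2 f) g + S.B p.1 f (X p.2 g) - X p.2 (S.B p.1 f g)) := by
  simp [defect, LinearMap.sum_apply]

theorem isDerivationUpTo_iff (n : ℕ) :
    S.IsDerivationUpTo n X ↔ ∀ m ≤ n, S.defect X m = 0 := by
  have key : ∀ m f g, S.defect X m f g =
      coeff m (starMul S.B (formalOp X (C f)) (C g) + starMul S.B (C f) (formalOp X (C g))) -
        coeff m (formalOp X (starMul S.B (C f) (C g))) := fun m f g => by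
    rw [map_add, coeff_starMul_C_right, coeff_starMul_C_left, coeff_formalOp]
    simp only [coeff_formalOp_C, coeff_starMul_C_C]
    rw [← Finset.Nat.sum_antidiagonal_swap (f := fun p : ℕ × ℕ => X p.1 (S.B p.2 f g)),
      defect_apply,
      Finset.sum_sub_distrib, Finset.sum_add_distrib]
    rfl
  constructor
  · intro h m hm
    ext f g
    rw [key, h f g m hm, sub_self]
    rfl
  · intro h f g m hm
    have := key m f g
    rw [h m hm] at this
    exact (sub_eq_zero.1 this.symm).symm

theorem gerstenhaber_B_zero (D : Cochain1 𝕜 A) : gerstenhaber (S.B 0) D = hochschild1 𝕜 A D := by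
  ext f g
  simp [S.B_zero]
  ring

/-- The top operator `X (n + 1)` is paired only with `B 0`, the multiplication, and thus enters
through its Hochschild differential alone. -/
theorem defect_succ (n : ℕ) :
    S.defect X (n + 1) = hochschild1 𝕜 A (X (n + 1)) - S.rhs n X := by
  ext f g
  rw [rhs, defect, Finset.Nat.sum_antidiagonal_eq_sum_range_succ
    (fun i j => gerstenhaber (S.B i) (X j)), Finset.sum_range_succ', Nat.sub_zero,
    gerstenhaber_B_zero, Finset.range_eq_Ico, Finset.sum_Ico_add' (fun k =>
      gerstenhaber (S.B k) (X (n + 1 - k))) 0 (n + 1) 1]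
  simp only [LinearMap.add_apply, LinearMap.sub_apply, LinearMap.neg_apply, sub_neg_eq_add]
  rw [add_comm]
  rfl

/-- The consequence of associativity for the defect of `𝒳`. -/
theorem sum_defect_eq_zero [CharZero 𝕜] (m : ℕ) (f g h : A) :
    ∑ p ∈ antidiagonal m, (S.B p.1 (S.defect X p.2 f g) h + S.defect X p.2 (S.B p.1 f g) h
      - S.B p.1 f (S.defect X p.2 g h) - S.defect X p.2 f (S.B p.1 g h)) = 0 := by
  let E : ℕ → ℕ → ℕ → A := fun i k l =>
    S.B i (gerstenhaber (S.B k) (X l) f g) h + gerstenhaber (S.B k) (X l) (S.B i f g) h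
      - S.B i f (gerstenhaber (S.B k) (X l) g h) - gerstenhaber (S.B k) (X l) f (S.B i g h)
  have hE : ∀ p ∈ antidiagonal m, (S.B p.1 (S.defect X p.2 f g) h
      + S.defect X p.2 (S.B p.1 f g) h - S.B p.1 f (S.defect X p.2 g h)
      - S.defect X p.2 f (S.B p.1 g h)) = ∑ q ∈ antidiagonal p.2, E p.1 q.1 q.2 := fun p _ => by
    simp only [E, defect, LinearMap.sum_apply, map_sum, Finset.sum_sub_distrib,
      Finset.sum_add_distrib]
  rw [Finset.sum_congr rfl hE, sum_antidiagonal_antidiagonal]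
  refine Finset.sum_eq_zero fun p _ => ?_
  let a : ℕ × ℕ → A → A → A → A := fun q u v w =>
    S.B q.1 (S.B q.2 u v) w - S.B q.1 u (S.B q.2 v w)
  -- `D` is `E` minus associator terms that sum to zero. What remains is antisymmetric under
  -- exchanging `i` and `k`, so its sum over the antidiagonal equals its own negative.
  let D : ℕ → ℕ → A := fun i k => E i k p.2 - (a (i, k) (X p.2 f) g h + a (i, k) f (X p.2 g) h
    + a (i, k) f g (X p.2 h) - X p.2 (a (i, k) f g h))
  have ha : ∀ u v w, ∑ q ∈ antidiagonal p.1, a q u v w = 0 := fun u v w => S.sum_assoc u v w p.1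
  have hD : ∑ q ∈ antidiagonal p.1, D q.1 q.2 = ∑ q ∈ antidiagonal p.1, E q.1 q.2 p.2 := by
    simp only [D, Finset.sum_sub_distrib, Finset.sum_add_distrib, ← map_sum, ha]
    simp
  rw [← hD]
  refine eq_zero_of_eq_neg_self 𝕜 ?_
  nth_rw 1 [← Finset.Nat.sum_antidiagonal_swap]
  rw [← Finset.sum_neg_distrib]
  refine Finset.sum_congr rfl fun q _ => ?_
  simp only [D, E, a, gerstenhaber_apply, map_sub, map_add, LinearMap.sub_apply,
    LinearMap.add_apply, Prod.fst_swap, Prod.snd_swap]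
  ring

end StarProduct

end StarProducts

/-! ### The obstruction and its dependence on the last coefficient. -/

section Obstruction

open Finset.HasAntidiagonal

variable {𝕜 A : Type*} [Field 𝕜] [CommRing A] [Algebra 𝕜 A]

theorem hochschild1_derivation (Y : Derivation 𝕜 A A) :
    hochschild1 𝕜 A (Y : Cochain1 𝕜 A) = 0 := by
  ext f g
  simp
  ring

theorem Poisson.H2class_eq_zero_iff {P : Poisson 𝕜 A} {Φ : Bivector 𝕜 A} (hΦ : P.d2 Φ = 0) :
    P.H2class Φ hΦ = 0 ↔ ∃ Y, P.d1 Y = Φ :=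
  (Submodule.Quotient.mk_eq_zero _).trans Iff.rfl

namespace StarProduct

variable {P : Poisson 𝕜 A} (S : StarProduct P) {X X' : ℕ → Cochain1 𝕜 A} {n : ℕ}

theorem rhs_mem_localCochain2 (hX : ∀ k ≤ n, X k ∈ localCochain1 𝕜 A) :
    S.rhs n X ∈ localCochain2 𝕜 A := by
  have h1 : ∑ k ∈ Finset.Icc 1 (n + 1), gerstenhaber (S.B k) (X (n + 1 - k)) ∈
      localCochain2 𝕜 A := Submodule.sum_mem _ fun k hk =>
    gerstenhaber_mem_localCochain2 (S.B_local k) (hX _ (by have := Finset.mem_Icc.1 hk; omega))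
  convert sub_mem_of_cochain2 (Submodule.zero_mem _) h1 using 1
  ext f g
  simp [rhs]

theorem rhs_congr (h : ∀ k ≤ n, X k = X' k) : S.rhs n X = S.rhs n X' := by
  unfold rhs
  congr 1
  refine Finset.sum_congr rfl fun k hk => ?_
  rw [h _ (by have := Finset.mem_Icc.1 hk; omega)]

theorem defect_congr (h : ∀ k ≤ n, X k = X' k) : S.defect X n = S.defect X' n := by
  refine Finset.sum_congr rfl fun p hp => ?_
  rw [h _ (by have := mem_antidiagonal.1 hp; omega)]

theorem gerstenhaber_B_one (Y : Derivation 𝕜 A A) :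
    gerstenhaber (S.B 1) (Y : Cochain1 𝕜 A) = (2⁻¹ : 𝕜) • (P.d1 Y).1 := by
  ext f g
  have h : P.bracket g (Y f) = -P.bracket (Y f) g := Bivector.skew P.π _ _
  simp only [gerstenhaber_apply, S.B_one, LinearMap.smul_apply, Poisson.d1_apply, h, map_smul,
    Derivation.coeFn_coe, ← smul_add, ← smul_sub]
  congr 1
  ring

/-- Only the bracket of `B 1` with `X 0` occurs, a multiple of `d_π X₀`, which vanishes for a
Poisson field. -/
theorem rhs_zero {X₀ : Derivation 𝕜 A A} (h : P.IsPoissonField X₀) (h0 : X 0 = X₀) :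
    S.rhs 0 X = 0 := by
  have hd : P.d1 X₀ = 0 := by
    ext f g
    have h1 : P.bracket g (X₀ f) = -P.bracket (X₀ f) g := Bivector.skew P.π _ _
    rw [Poisson.d1_apply, h f g, h1]
    change _ = (0 : A)
    ring
  have : S.rhs 0 X = -gerstenhaber (S.B 1) (X 0) := by simp [rhs]
  rw [this, h0, gerstenhaber_B_one, hd]
  ext f g
  change -((2⁻¹ : 𝕜) • (0 : A)) = 0
  simp

/-- Only the term `k = 1` contains `X n`; the factor `2⁻¹` is that of `B 1`. -/
theorem rhs_update (Y : Derivation 𝕜 A A) :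
    S.rhs n (Function.update X n (X n + Y)) = S.rhs n X - (2⁻¹ : 𝕜) • (P.d1 Y).1 := by
  have key : ∀ k ∈ Finset.Icc 1 (n + 1),
      gerstenhaber (S.B k) (Function.update X n (X n + Y) (n + 1 - k)) =
        gerstenhaber (S.B k) (X (n + 1 - k)) +
          if k = 1 then gerstenhaber (S.B 1) (Y : Cochain1 𝕜 A) else 0 := fun k hk => by
    have hk' := Finset.mem_Icc.1 hk
    by_cases h1 : k = 1
    · subst h1
      ext f g
      simp
      ring
    · rw [Function.update_of_ne (by omega), if_neg h1, add_zero]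
  ext f g
  unfold rhs
  rw [Finset.sum_congr rfl key, Finset.sum_add_distrib, Finset.sum_ite_eq', if_pos (by simp),
    gerstenhaber_B_one]
  simp only [LinearMap.neg_apply, LinearMap.add_apply, LinearMap.sub_apply]
  ring

/-- In degree `n` the operator `X n` enters only through its Hochschild differential, which kills
derivations. -/
theorem defect_update (Y : Derivation 𝕜 A A) :
    S.defect (Function.update X n (X n + Y)) n = S.defect X n := by
  rcases n with _ | n
  · have h0 : ∀ X : ℕ → Cochain1 𝕜 A, S.defect X 0 = hochschild1 𝕜 A (X 0) := fun X => by
      simp [defect, gerstenhaber_B_zero]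
    rw [h0, h0, Function.update_self, map_add, hochschild1_derivation, add_zero]
  · rw [defect_succ, defect_succ, Function.update_self, map_add, hochschild1_derivation, add_zero,
      S.rhs_congr (X' := X) fun k hk => Function.update_of_ne (by omega) _ _]

theorem isDerivationUpTo_succ_iff (hX : S.IsDerivationUpTo n X) (Y : Derivation 𝕜 A A)
    (Z : Cochain1 𝕜 A) :
    S.IsDerivationUpTo (n + 1)
        (Function.update (Function.update X n (X n + Y)) (n + 1) Z) ↔
      hochschild1 𝕜 A Z = S.rhs n (Function.update X n (X n + Y)) := by
  rw [isDerivationUpTo_iff] at hX ⊢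
  have h1 : S.defect (Function.update (Function.update X n (X n + Y)) (n + 1) Z) (n + 1) =
      hochschild1 𝕜 A Z - S.rhs n (Function.update X n (X n + Y)) := by
    rw [defect_succ, Function.update_self,
      S.rhs_congr (X' := Function.update X n (X n + Y))
        fun k hk => Function.update_of_ne (by omega) _ _]
  have h2 : ∀ m ≤ n,
      S.defect (Function.update (Function.update X n (X n + Y)) (n + 1) Z) m = 0 := fun m hm => by
    rw [S.defect_congr (X' := Function.update X n (X n + Y))
      fun k hk => Function.update_of_ne (by omega) _ _]
    rcases hm.lt_or_eq with hlt | rfl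
    · rw [S.defect_congr (X' := X) fun k hk => Function.update_of_ne (by omega) _ _, hX m hm]
    · rw [defect_update, hX m hm]
  constructor
  · intro h
    exact sub_eq_zero.1 (h1.symm.trans (h (n + 1) le_rfl))
  · intro h m hm
    rcases hm.lt_or_eq with hlt | rfl
    · exact h2 m (Nat.lt_succ_iff.1 hlt)
    · rw [h1, h]
      ext f g
      exact sub_self _

/-! ### Closedness of the obstruction. -/

section Cocycle

variable [CharZero 𝕜]

/-- The defect of order `n + 2` of the truncation of `𝒳` after order `n` relates the Hochschild
differential of the obstruction to its bracket with the Poisson structure. -/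
theorem exists_hochschild2_eq (hX : S.IsDerivationUpTo n X) :
    hochschild2 𝕜 A (S.rhs n X) = 0 ∧ ∃ E : Cochain2 𝕜 A, ∀ f g h,
      E f g * h + E (f * g) h - f * E g h - E f (g * h) =
        P.π.1 (S.rhs n X f g) h + S.rhs n X (P.π.1 f g) h - P.π.1 f (S.rhs n X g h)
          - S.rhs n X f (P.π.1 g h) := by
  -- After truncation the defect in degree `n + 1` is exactly `-R`, whatever the later values of `X`
  -- are.
  let X' : ℕ → Cochain1 𝕜 A := fun k => if k ≤ n then X k else 0
  have hX'X : ∀ k ≤ n, X' k = X k := fun k hk => if_pos hk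
  have hlow : ∀ m ≤ n, S.defect X' m = 0 := fun m hm => by
    rw [S.defect_congr fun k hk => hX'X k (hk.trans hm), (S.isDerivationUpTo_iff X n).1 hX m hm]
  have hR : ∀ f g, S.defect X' (n + 1) f g = -S.rhs n X f g := fun f g => by
    rw [defect_succ, S.rhs_congr hX'X]
    simp [X']
  have htail : ∀ (F : ℕ → ℕ) (f g h : A), ∑ p ∈ antidiagonal n,
      (S.B (F p.1) (S.defect X' p.2 f g) h + S.defect X' p.2 (S.B (F p.1) f g) h
      - S.B (F p.1) f (S.defect X' p.2 g h) - S.defect X' p.2 f (S.B (F p.1) g h)) = 0 :=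
    fun F f g h => Finset.sum_eq_zero fun p hp => by
      rw [hlow p.2 (by have := mem_antidiagonal.1 hp; omega)]
      simp
  constructor
  · ext f g h
    have h1 := S.sum_defect_eq_zero X' (n + 1) f g h
    rw [Finset.Nat.sum_antidiagonal_succ, htail (· + 1)] at h1
    simp only [hR, S.B_zero] at h1
    simp only [hochschild2_apply]
    change _ = (0 : A)
    linear_combination h1
  -- In degree `n + 2` only `B 0` with the unknown defect and `B 1` with `-R` survive; the factor
  -- `2` cancels the one half in `B 1`.
  · refine ⟨(2 : 𝕜) • S.defect X' (n + 2), fun f g h => ?_⟩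
    have h1 := S.sum_defect_eq_zero X' (n + 2) f g h
    rw [Finset.Nat.sum_antidiagonal_succ, Finset.Nat.sum_antidiagonal_succ,
      htail (· + 1 + 1)] at h1
    simp only [hR, S.B_zero, S.B_one, zero_add, map_neg, map_smul, LinearMap.smul_apply,
      LinearMap.neg_apply, add_zero] at h1
    have h2 := congrArg ((2 : 𝕜) • ·) h1
    simp only [smul_add, smul_sub, smul_neg, smul_smul, smul_zero,
      mul_inv_cancel₀ (two_ne_zero' 𝕜), one_smul, Poisson.bracket] at h2
    simp only [LinearMap.smul_apply, smul_mul_assoc, mul_smul_comm]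
    linear_combination h2

theorem rhs_mem_localCocycle2 (hX : S.IsDerivationUpTo n X)
    (hXloc : ∀ k ≤ n, X k ∈ localCochain1 𝕜 A) : S.rhs n X ∈ localCocycle2 𝕜 A :=
  ⟨S.rhs_mem_localCochain2 hXloc, LinearMap.mem_ker.2 (S.exists_hochschild2_eq hX).1⟩

/-- The terms in `E` form a Hochschild coboundary, which disappears under antisymmetrization over
the six permutations of `f`, `g`, `h`. The other side produces every term of the differential twice,
so the conclusion is reached in the form `a = -a`. -/
theorem d2_antisymm_rhs (hX : S.IsDerivationUpTo n X) (hR : S.rhs n X ∈ localCocycle2 𝕜 A) :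
    P.d2 (antisymm (S.rhs n X) hR) = 0 := by
  obtain ⟨E, hE⟩ := (S.exists_hochschild2_eq hX).2
  generalize S.rhs n X = R at hE hR
  ext f g h
  change _ = (0 : A)
  have sk : ∀ a b, P.π.1 a b = -P.π.1 b a := fun a b => Bivector.skew P.π a b
  simp only [Poisson.d2_apply, antisymm_apply, Poisson.bracket, map_smul, ← smul_add, ← smul_sub]
  refine smul_eq_zero_of_right _ (eq_zero_of_eq_neg_self 𝕜 ?_)
  have e1 := hE f g h
  have e2 := hE g f h
  have e3 := hE g h f
  have e4 := hE f h g
  have e5 := hE h f g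
  have e6 := hE h g f
  simp only [mul_comm g f, mul_comm h f, mul_comm h g, sk g f, sk h f, sk h g, sk (R _ _),
    map_neg, LinearMap.neg_apply] at e1 e2 e3 e4 e5 e6
  simp only [map_sub]
  linear_combination e1 - e2 + e3 - e4 + e5 - e6

end Cocycle

end StarProduct

/-- The obstruction theory for an algebra whose derivations have a dual frame. -/
theorem IsDualFrame.obstruction [CharZero 𝕜] {ι : Type*} [Fintype ι] {x : ι → A}
    {e : ι → Derivation 𝕜 A A} (hxe : IsDualFrame x e) {P : Poisson 𝕜 A} (S : StarProduct P)
    (n : ℕ) (X : ℕ → Cochain1 𝕜 A) (X₀ : Derivation 𝕜 A A) (hX₀ : P.IsPoissonField X₀)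
    (hX_zero : X 0 = X₀) (hX_local : ∀ k ≤ n, X k ∈ localCochain1 𝕜 A)
    (hX : S.IsDerivationUpTo n X) :
    ∃ (hR : S.rhs n X ∈ localCocycle2 𝕜 A) (Φ : Bivector 𝕜 A),
      (∀ Ψ : Bivector 𝕜 A, hkr 𝕜 _ Ψ = hochschildClass (S.rhs n X) hR ↔ Ψ = Φ) ∧
      ∃ hΦ : P.d2 Φ = 0,
        ((∃ Y : Derivation 𝕜 A A, (n = 0 → Y = 0) ∧ ∃ Z ∈ localCochain1 𝕜 A,
            hochschild1 𝕜 _ Z = S.rhs n (Function.update X n (X n + Y)))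
          ↔ P.H2class Φ hΦ = 0) ∧
        ((∃ Y : Derivation 𝕜 A A, (n = 0 → Y = 0) ∧ ∃ Z ∈ localCochain1 𝕜 A,
            S.IsDerivationUpTo (n + 1)
              (Function.update (Function.update X n (X n + Y)) (n + 1) Z))
          ↔ P.H2class Φ hΦ = 0) := by
  have hR := S.rhs_mem_localCocycle2 hX hX_local
  have hΦ := S.d2_antisymm_rhs hX hR
  have key : (∃ Y : Derivation 𝕜 A A, (n = 0 → Y = 0) ∧ ∃ Z ∈ localCochain1 𝕜 A,
      hochschild1 𝕜 _ Z = S.rhs n (Function.update X n (X n + Y))) ↔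
        P.H2class (antisymm (S.rhs n X) hR) hΦ = 0 := by
    rw [Poisson.H2class_eq_zero_iff]
    by_cases hn : n = 0
    -- Both sides hold here: the obstruction is zero, and `Y = 0`, `Z = 0` is a solution.
    · subst hn
      have hR0 := S.rhs_zero hX₀ hX_zero
      constructor
      · rintro -
        refine ⟨0, ?_⟩
        rw [map_zero]
        ext f g
        rw [antisymm_apply, hR0]
        change (0 : A) = _
        simp
      · rintro -
        refine ⟨0, fun _ => rfl, 0, Submodule.zero_mem _, ?_⟩
        rw [map_zero, S.rhs_zero hX₀]
        simp [hX_zero]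
    -- For a fixed `Y`, solvability says that `R` and half of `d_π Y` are cohomologous; uniqueness
    -- of the representing bivector field makes this an equality.
    · have hcob : ∀ Y : Derivation 𝕜 A A, (∃ Z ∈ localCochain1 𝕜 A,
          hochschild1 𝕜 _ Z = S.rhs n (Function.update X n (X n + Y))) ↔
            P.d1 ((2⁻¹ : 𝕜) • Y) = antisymm (S.rhs n X) hR := fun Y => by
        rw [← hkr_eq_hochschildClass_iff_eq_antisymm hxe hR, hkr_eq_hochschildClass_iff,
          S.rhs_update, map_smul]
        change _ ∈ localCoboundary2 𝕜 A ↔ _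
        have hneg : ∀ {c c' : Cochain2 𝕜 A}, c - c' ∈ localCoboundary2 𝕜 A →
            c' - c ∈ localCoboundary2 𝕜 A := fun {c c'} h => by
          convert sub_mem_of_cochain2 (Submodule.zero_mem _) h using 1
          ext f g
          simp
        exact ⟨hneg, hneg⟩
      constructor
      · rintro ⟨Y, -, hY⟩
        exact ⟨_, (hcob Y).1 hY⟩
      · rintro ⟨Y, hY⟩
        refine ⟨(2 : 𝕜) • Y, fun h => absurd h hn, (hcob _).2 ?_⟩
        rw [smul_smul, inv_mul_cancel₀ two_ne_zero, one_smul, hY]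
  refine ⟨hR, antisymm _ hR, hkr_eq_hochschildClass_iff_eq_antisymm hxe hR, hΦ, key, ?_⟩
  rw [← key]
  simp only [S.isDerivationUpTo_succ_iff hX]

end Obstruction

end DefQuant

set_option maxHeartbeats 800000 in
theorem mainTheorem4 {𝕜 : Type*} [RCLike 𝕜] {d : ℕ} {M : Type*} [TopologicalSpace M]
    [ChartedSpace (EuclideanSpace ℝ (Fin d)) M] [IsManifold (𝓡 d) ∞ M] [T2Space M]
    [CompactSpace M]
    (P : DefQuant.Poisson 𝕜 (DefQuant.SmoothFunctions 𝕜 d M)) (S : DefQuant.StarProduct P)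
    (n : ℕ) (X : ℕ → DefQuant.Cochain1 𝕜 (DefQuant.SmoothFunctions 𝕜 d M))
    (X₀ : Derivation 𝕜 (DefQuant.SmoothFunctions 𝕜 d M) (DefQuant.SmoothFunctions 𝕜 d M))
    (hX₀ : P.IsPoissonField X₀) (hX_zero : X 0 = X₀)
    (hX_local : ∀ k ≤ n, X k ∈ DefQuant.localCochain1 𝕜 (DefQuant.SmoothFunctions 𝕜 d M))
    (hX : S.IsDerivationUpTo n X) :
    ∃ (hR : S.rhs n X ∈ DefQuant.localCocycle2 𝕜 (DefQuant.SmoothFunctions 𝕜 d M))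
      (Φ : DefQuant.Bivector 𝕜 (DefQuant.SmoothFunctions 𝕜 d M)),
      (∀ Ψ : DefQuant.Bivector 𝕜 (DefQuant.SmoothFunctions 𝕜 d M),
        DefQuant.hkr 𝕜 _ Ψ = DefQuant.hochschildClass (S.rhs n X) hR ↔ Ψ = Φ) ∧
      ∃ hΦ : P.d2 Φ = 0,
        ((∃ Y : Derivation 𝕜 (DefQuant.SmoothFunctions 𝕜 d M) (DefQuant.SmoothFunctions 𝕜 d M),
          (n = 0 → Y = 0) ∧
          ∃ Z ∈ DefQuant.localCochain1 𝕜 (DefQuant.SmoothFunctions 𝕜 d M),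
            DefQuant.hochschild1 𝕜 _ Z = S.rhs n (Function.update X n (X n + Y)))
          ↔ P.H2class Φ hΦ = 0) ∧
        ((∃ Y : Derivation 𝕜 (DefQuant.SmoothFunctions 𝕜 d M) (DefQuant.SmoothFunctions 𝕜 d M),
          (n = 0 → Y = 0) ∧
          ∃ Z ∈ DefQuant.localCochain1 𝕜 (DefQuant.SmoothFunctions 𝕜 d M),
            S.IsDerivationUpTo (n + 1)
              (Function.update (Function.update X n (X n + Y)) (n + 1) Z))
          ↔ P.H2class Φ hΦ = 0) := by
  obtain ⟨_, _, _, hxe⟩ := DefQuant.exists_isDualFrame_smoothFunctions 𝕜 d M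
  exact hxe.obstruction S n X X₀ hX₀ hX_zero hX_local hX
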